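/- **Setting.** Simple types are built from basic types by $\to$; there are typed function symbols and infinitely many variables of each type. *Terms* are the simply typed $\lambda$-terms in $\eta$-long $\beta$-normal form, up to $\alpha$-equivalence; $t{\downarrow}$ is the $\eta$-long $\beta$-normal form of a simply typed $\lambda$-preterm $t$. Every term has the form $\lambda x_1\ldots x_m.\,a(t_1,\ldots,t_n)$ with $a$ a function symbol or a variable; $a$ is its top, and $\mathit{args}$ denotes the set $\{t_1,\ldots,t_n\}$. $Sub(t)$ is the set of subterms of $t$; the stable subterms of $t$ ($SSub(t)$) are the subterms reached from $t$ without entering an argument of a free variable of $t$. Bound variables are always chosen distinct and different from all free variables in play. Substitutions map variables to terms of the same type and have finite domain. A *higher-order rewrite system* (HRS) $R$ is a set of rules $l\to r$ between terms of the same basic type with $FV(r)\subseteq FV(l)$ such that the top of $l$ is a function symbol; $s\to_R t$ iff $s=C[l\theta{\downarrow}]$ and $t=C[r\theta{\downarrow}]$ for some rule $l\to r$ of $R$, context $C$ and substitution $\theta$. $R$ is *terminating* if no term starts an infinite $\to_R$-sequence. A term $t$ is *strongly computable* if it has basic type and starts no infinite $\to_R$-sequence, or has type $\alpha\to\beta$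 and $(t\,u){\downarrow}$ is strongly computable for every strongly computable term $u$ of type $\alpha$. **Safe subterms.** $\mathit{safe}(l)$ is the set of all $t{\downarrow}$ with $t\in Acc(l')$ and $FV(t)\subseteq FV(l')$ for some $l'\in\mathit{args}(l)$, where $Acc(l')$ is the least set of preterms such that $t\in Acc(l')$ if one of the following holds: (0) $t=l'$; (1) $t\in SSub(l')$, $t$ has basic type and $FV(t)\subseteq FV(l')$; (2) $\lambda x.t\in Acc(l')$ and $x\notin FV(l')$; (3) $t(x{\downarrow})\in Acc(l')$ and $x\notin FV(t)\cup FV(l')$; (4) $f(t_1,\ldots,t_n)\in Acc(l')$ with $f$ a function symbol, $t_i=\lambda x_1\ldots x_k.t$ for some $i$ and $k\ge 0$, $t$ has basic type and no $x_j$ is free in $t$; (5) $x(t_1,\ldots,t_n)\in Acc(l')$, $t=t_i$ for some $i$, and the variable $x$ is not in $FV(t_1)\cup\dots\cup FV(t_n)\cup FV(l')$. $R$ is *plain function-passing* (PFP) if for every rule $l\to r$ of $R$ and every $Z(r_1,\ldots,r_n)\in Sub(r)$ with $Z\in FV(r)$ there is $0\le k\le n$ with $Z(r_1,\ldots,r_k){\downarrow}\in\mathit{safe}(l)$.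 **Static dependency chains.** The *defined symbols* are the tops of the left-hand sides of $R$. For each defined $f$ let $f^\sharp$ be a new symbol, and let $t^\sharp=f^\sharp(t_1,\ldots,t_n)$ if $t=f(t_1,\ldots,t_n)$ with $f$ defined, and $t^\sharp=t$ otherwise. Let $Cand(\lambda x_1\ldots x_m.a(t_1,\ldots,t_n))=\{\lambda x_1\ldots x_m.a(t_1,\ldots,t_n)\}\cup\bigcup_i Cand(\lambda x_1\ldots x_m.t_i)$. A *static dependency pair* is a pair $l^\sharp\to a^\sharp(r_1,\ldots,r_n)$ such that, for some rule $l\to r$ of $R$, $\lambda x_1\ldots x_m.a(r_1,\ldots,r_n)\in Cand(r)$, $a$ is defined, and $a(r_1,\ldots,r_k){\downarrow}\notin\mathit{safe}(l)$ for all $0\le k\le n$. An *infinite static dependency chain* is a sequence $u_0^\sharp\to v_0^\sharp,\ u_1^\sharp\to v_1^\sharp,\ldots$ of static dependency pairs for which there are substitutions $\theta_0,\theta_1,\ldots$ such that for all $i$: $v_i^\sharp\theta_i{\downarrow}\to_R^* u_{i+1}^\sharp\theta_{i+1}{\downarrow}$, and all arguments of $u_i\theta_i{\downarrow}$ and of $v_i\theta_i{\downarrow}$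 are strongly computable. **Proposition.** Let $R$ be a plain function-passing HRS. If there is no infinite static dependency chain in $R$, then $R$ is terminating. -/

import Mathlib

universe u v w x

/-- Simple types over a set `B` of basic types. -/
inductive SimpleType (B : Type u) : Type u
  | base : B → SimpleType B
  | arr : SimpleType B → SimpleType B → SimpleType B

/-- Bound variables of type `α` in a binding context `Γ` (typed de Bruijn indices; the innermost
binder is the head of the list). -/
inductive BVar {B : Type u} : List (SimpleType B) → SimpleType B → Type u
  | zero {Γ : List (SimpleType B)} {α : SimpleType B} : BVar (α :: Γ) α
  | succ {Γ : List (SimpleType B)} {α β : SimpleType B} : BVar Γ α → BVar (β :: Γ) α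

/-- Simply typed preterms up to `α`-equivalence: function symbols `F α` and free variables `V α` of
each type `α`, application and abstraction. The preterms in the usual sense are those in the empty
binding context; `Preterm F V Γ α` contains the bodies found under binders of types `Γ`. -/
inductive Preterm {B : Type u} (F : SimpleType B → Type v) (V : SimpleType B → Type w) :
    List (SimpleType B) → SimpleType B → Type (max u v w)
  | fvar {Γ : List (SimpleType B)} {α : SimpleType B} : V α → Preterm F V Γ α
  | bvar {Γ : List (SimpleType B)} {α : SimpleType B} : BVar Γ α → Preterm F V Γ α
  | sym {Γ : List (SimpleType B)} {α : SimpleType B} : F α → Preterm F V Γ α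
  | lam {Γ : List (SimpleType B)} {α β : SimpleType B} :
      Preterm F V (α :: Γ) β → Preterm F V Γ (SimpleType.arr α β)
  | app {Γ : List (SimpleType B)} {α β : SimpleType B} :
      Preterm F V Γ (SimpleType.arr α β) → Preterm F V Γ α → Preterm F V Γ β

namespace Preterm

variable {B : Type u} {F : SimpleType B → Type v} {V : SimpleType B → Type w}

/-- Extension of a renaming of bound variables under one more binder. -/
def liftRen {Γ Δ : List (SimpleType B)} {α : SimpleType B} (ρ : ∀ γ, BVar Γ γ → BVar Δ γ) :
    ∀ γ, BVar (α :: Γ) γ → BVar (α :: Δ) γ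
  | _, .zero => .zero
  | _, .succ i => .succ (ρ _ i)

/-- Renaming of the bound variables of the binding context. -/
def ren : ∀ {Γ : List (SimpleType B)} {α : SimpleType B}, Preterm F V Γ α →
    ∀ {Δ : List (SimpleType B)}, (∀ γ, BVar Γ γ → BVar Δ γ) → Preterm F V Δ α
  | _, _, .fvar y, _, _ => .fvar y
  | _, _, .bvar i, _, ρ => .bvar (ρ _ i)
  | _, _, .sym f, _, _ => .sym f
  | _, _, .lam s, _, ρ => .lam (s.ren (liftRen ρ))
  | _, _, .app s t, _, ρ => .app (s.ren ρ) (t.ren ρ)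

/-- Weakening by one binder (the new bound variable does not occur). -/
def wk {Γ : List (SimpleType B)} {α β : SimpleType B} (t : Preterm F V Γ α) :
    Preterm F V (β :: Γ) α :=
  t.ren (fun _ i => .succ i)

/-- A preterm without dangling bound variables, seen under the binders `Δ` (none of which it
uses). -/
def under (Δ : List (SimpleType B)) {α : SimpleType B} (t : Preterm F V [] α) :
    Preterm F V Δ α :=
  t.ren (fun _ i => nomatch i)

/-- Extension of a substitution for bound variables under one more binder. -/
def liftSub {Γ Δ : List (SimpleType B)} {α : SimpleType B}
    (σ : ∀ γ, BVar Γ γ → Preterm F V Δ γ) : ∀ γ, BVar (α :: Γ) γ → Preterm F V (α :: Δ) γ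
  | _, .zero => .bvar .zero
  | _, .succ i => (σ _ i).wk

/-- Capture-avoiding simultaneous substitution of `θ` for the free variables and of `σ` for the
variables of the binding context (without normalization). -/
def bind : ∀ {Γ : List (SimpleType B)} {α : SimpleType B}, Preterm F V Γ α →
    ∀ {Δ : List (SimpleType B)}, (∀ γ, V γ → Preterm F V Δ γ) →
      (∀ γ, BVar Γ γ → Preterm F V Δ γ) → Preterm F V Δ α
  | _, _, .fvar y, _, θ, _ => θ _ y
  | _, _, .bvar i, _, _, σ => σ _ i
  | _, _, .sym f, _, _, _ => .sym f
  | _, _, .lam s, _, θ, σ => .lam (s.bind (fun γ y => (θ γ y).wk) (liftSub σ))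
  | _, _, .app s t, _, θ, σ => .app (s.bind θ σ) (t.bind θ σ)

/-- The substitution sending the innermost bound variable to `u`. -/
def headSub {Γ : List (SimpleType B)} {α : SimpleType B} (u : Preterm F V Γ α) :
    ∀ γ, BVar (α :: Γ) γ → Preterm F V Γ γ
  | _, .zero => u
  | _, .succ i => .bvar i

/-- `s.inst u` is the body `s` of an abstraction with `u` substituted for its bound variable. In
particular `lam s` is the `α`-class of `λx. s.inst (fvar x)` for each `x` not free in `lam s`. -/
def inst {Γ : List (SimpleType B)} {α β : SimpleType B} (s : Preterm F V (α :: Γ) β)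
    (u : Preterm F V Γ α) : Preterm F V Γ β :=
  s.bind (fun _ y => .fvar y) (headSub u)

/-- `t.named ρ` is the preterm `t` with the name `ρ i` given to each variable `i` of its binding
context. -/
def named {Γ : List (SimpleType B)} {α : SimpleType B} (t : Preterm F V Γ α)
    (ρ : ∀ γ, BVar Γ γ → V γ) : Preterm F V [] α :=
  t.bind (fun _ y => .fvar y) (fun _ i => .fvar (ρ _ i))

/-- The set of free variables, with their types. -/
def fv : ∀ {Γ : List (SimpleType B)} {α : SimpleType B}, Preterm F V Γ α → Set (Σ γ, V γ)
  | _, _, .fvar y => {⟨_, y⟩}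
  | _, _, .bvar _ => ∅
  | _, _, .sym _ => ∅
  | _, _, .lam s => s.fv
  | _, _, .app s t => s.fv ∪ t.fv

/-- `βη`-conversion of typed preterms. -/
inductive Conv : ∀ {Γ : List (SimpleType B)} {α : SimpleType B},
    Preterm F V Γ α → Preterm F V Γ α → Prop
  | beta {Γ : List (SimpleType B)} {α β : SimpleType B} (s : Preterm F V (α :: Γ) β)
      (u : Preterm F V Γ α) : Conv (.app (.lam s) u) (s.inst u)
  | eta {Γ : List (SimpleType B)} {α β : SimpleType B}
      (t : Preterm F V Γ (SimpleType.arr α β)) : Conv (.lam (.app t.wk (.bvar .zero))) t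
  | lam {Γ : List (SimpleType B)} {α β : SimpleType B} {s t : Preterm F V (α :: Γ) β} :
      Conv s t → Conv (.lam s) (.lam t)
  | app {Γ : List (SimpleType B)} {α β : SimpleType B}
      {s s' : Preterm F V Γ (SimpleType.arr α β)} {t t' : Preterm F V Γ α} :
      Conv s s' → Conv t t' → Conv (.app s t) (.app s' t')
  | refl {Γ : List (SimpleType B)} {α : SimpleType B} (t : Preterm F V Γ α) : Conv t t
  | symm {Γ : List (SimpleType B)} {α : SimpleType B} {s t : Preterm F V Γ α} :
      Conv s t → Conv t s
  | trans {Γ : List (SimpleType B)} {α : SimpleType B} {s t t' : Preterm F V Γ α} :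
      Conv s t → Conv t t' → Conv s t'

mutual

/-- `a t₁ … tₙ` with `a` a variable or a function symbol and every `tᵢ` in `η`-long `β`-normal
form (possibly not fully applied). -/
inductive IsNeutral : ∀ {Γ : List (SimpleType B)} {α : SimpleType B}, Preterm F V Γ α → Prop
  | fvar {Γ : List (SimpleType B)} {α : SimpleType B} (y : V α) :
      IsNeutral (.fvar y : Preterm F V Γ α)
  | bvar {Γ : List (SimpleType B)} {α : SimpleType B} (i : BVar Γ α) :
      IsNeutral (.bvar i : Preterm F V Γ α)
  | sym {Γ : List (SimpleType B)} {α : SimpleType B} (f : F α) :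
      IsNeutral (.sym f : Preterm F V Γ α)
  | app {Γ : List (SimpleType B)} {α β : SimpleType B}
      {s : Preterm F V Γ (SimpleType.arr α β)} {t : Preterm F V Γ α} :
      IsNeutral s → IsTerm t → IsNeutral (.app s t)

/-- The terms: preterms in `η`-long `β`-normal form. -/
inductive IsTerm : ∀ {Γ : List (SimpleType B)} {α : SimpleType B}, Preterm F V Γ α → Prop
  | lam {Γ : List (SimpleType B)} {α β : SimpleType B} {s : Preterm F V (α :: Γ) β} :
      IsTerm s → IsTerm (.lam s)
  | base {Γ : List (SimpleType B)} {b : B} {t : Preterm F V Γ (SimpleType.base b)} :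
      IsNeutral t → IsTerm t

end

open Classical in
/-- The `η`-long `β`-normal form `t↓` of `t`: the term that is `βη`-convertible with `t` (it exists
and is unique, so that the default value is never used). -/
noncomputable def nf {Γ : List (SimpleType B)} {α : SimpleType B} (t : Preterm F V Γ α) :
    Preterm F V Γ α :=
  if h : ∃ n : Preterm F V Γ α, n.IsTerm ∧ Conv t n then h.choose else t

/-- `p.IsPrefix t`: `t = p u₁ … uₙ` for some `n ≥ 0`. If `t = a(t₁, …, tₙ)` with `a` a symbol or a
variable, these are the `a(t₁, …, tₖ)` with `0 ≤ k ≤ n`, and `a` is the only symbol or variable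
among them. -/
inductive IsPrefix {Γ : List (SimpleType B)} {α : SimpleType B} (p : Preterm F V Γ α) :
    ∀ {β : SimpleType B}, Preterm F V Γ β → Prop
  | refl : IsPrefix p p
  | app {β γ : SimpleType B} {s : Preterm F V Γ (SimpleType.arr β γ)} {t : Preterm F V Γ β} :
      IsPrefix p s → IsPrefix p (.app s t)

/-- `u.IsArg t`: `t = a(t₁, …, tₙ)` and `u` is one of the arguments `t₁, …, tₙ`. -/
def IsArg {Γ : List (SimpleType B)} {α β : SimpleType B} (u : Preterm F V Γ α)
    (t : Preterm F V Γ β) : Prop :=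
  ∃ (γ : SimpleType B) (p : Preterm F V Γ (SimpleType.arr α γ)), (Preterm.app p u).IsPrefix t

/-- `t.Sub u`: `u` is a subterm of `t`. The subterm `u` lives in the binding context consisting of
the binders of `t` above it. -/
inductive Sub : ∀ {Γ Δ : List (SimpleType B)} {α β : SimpleType B},
    Preterm F V Γ α → Preterm F V Δ β → Prop
  | refl {Γ : List (SimpleType B)} {α : SimpleType B} (t : Preterm F V Γ α) : Sub t t
  | lam {Γ Δ : List (SimpleType B)} {α α' β : SimpleType B} {s : Preterm F V (α' :: Γ) α}
      {u : Preterm F V Δ β} : Sub s u → Sub (.lam s) u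
  | arg {Γ Δ : List (SimpleType B)} {α α' β : SimpleType B} {t : Preterm F V Γ α}
      {t' : Preterm F V Γ α'} {u : Preterm F V Δ β} : t'.IsArg t → Sub t' u → Sub t u

/-- `t.Cand u`, for `t` in context `Γ = y₁ … yₖ` and `u` in context `Δ = x₁ … xₘ`:
the term `λx₁ … xₘ. u` is one of the candidate subterms of `λy₁ … yₖ. t`. Those of
`λx₁ … xₘ. a(t₁, …, tₙ)` are itself and the candidate subterms of the `λx₁ … xₘ. tᵢ`. -/
inductive Cand : ∀ {Γ Δ : List (SimpleType B)} {α β : SimpleType B},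
    Preterm F V Γ α → Preterm F V Δ β → Prop
  | self {Γ : List (SimpleType B)} {α : SimpleType B} (t : Preterm F V Γ α) : Cand t t
  | lam {Γ Δ : List (SimpleType B)} {α α' β : SimpleType B} {s : Preterm F V (α' :: Γ) α}
      {u : Preterm F V Δ β} : Cand s u → Cand (.lam s) u
  | arg {Γ Δ : List (SimpleType B)} {α α' β : SimpleType B} {t : Preterm F V Γ α}
      {t' : Preterm F V Γ α'} {u : Preterm F V Δ β} : t'.IsArg t → Cand t' u → Cand t u

/-- `t.SSub u`: `u` is a stable subterm of `t`, i.e. a subterm that is not below an argument of a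
free variable of `t`. (The free variables of `t` are the `fvar`s; variables bound in `t` are
`bvar`s.) -/
inductive SSub : ∀ {Γ Δ : List (SimpleType B)} {α β : SimpleType B},
    Preterm F V Γ α → Preterm F V Δ β → Prop
  | refl {Γ : List (SimpleType B)} {α : SimpleType B} (t : Preterm F V Γ α) : SSub t t
  | lam {Γ Δ : List (SimpleType B)} {α α' β : SimpleType B} {s : Preterm F V (α' :: Γ) α}
      {u : Preterm F V Δ β} : SSub s u → SSub (.lam s) u
  | arg {Γ Δ : List (SimpleType B)} {α α' β : SimpleType B} {t : Preterm F V Γ α}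
      {t' : Preterm F V Γ α'} {u : Preterm F V Δ β} :
      (∀ (γ : SimpleType B) (y : V γ), ¬ (Preterm.fvar y : Preterm F V Γ γ).IsPrefix t) →
      t'.IsArg t → SSub t' u → SSub t u

/-- `s.IsVacuousAbs t`: `s = λx₁ … xₖ. t` with `k ≥ 0` and no `xᵢ` free in `t`. -/
inductive IsVacuousAbs {β : SimpleType B} (t : Preterm F V [] β) :
    ∀ {α : SimpleType B}, Preterm F V [] α → Prop
  | refl : IsVacuousAbs t t
  | lam {α γ : SimpleType B} {s : Preterm F V [] α} :
      IsVacuousAbs t s → IsVacuousAbs t (.lam (s.wk : Preterm F V [γ] α))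

/-- `l'.Accessible t`: the preterm `t` is accessible in `l'`. -/
inductive Accessible {δ : SimpleType B} (l' : Preterm F V [] δ) :
    ∀ {α : SimpleType B}, Preterm F V [] α → Prop
  | self : Accessible l' l'
  | sub {b : B} (t : Preterm F V [] (SimpleType.base b)) (Δ : List (SimpleType B)) :
      l'.SSub (t.under Δ) → t.fv ⊆ l'.fv → Accessible l' t
  | abs {α β : SimpleType B} (s : Preterm F V [α] β) (y : V α) :
      Accessible l' (.lam s) → (⟨α, y⟩ : Σ γ, V γ) ∉ (Preterm.lam s).fv →
      (⟨α, y⟩ : Σ γ, V γ) ∉ l'.fv → Accessible l' (s.inst (.fvar y))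
  | eta {α β : SimpleType B} (t : Preterm F V [] (SimpleType.arr α β)) (y : V α) :
      Accessible l' (.app t (nf (.fvar y))) → (⟨α, y⟩ : Σ γ, V γ) ∉ t.fv ∪ l'.fv →
      Accessible l' t
  | func {α γ ε : SimpleType B} {b : B} (f : F γ) (s : Preterm F V [] α) (ti : Preterm F V [] ε)
      (t : Preterm F V [] (SimpleType.base b)) :
      Accessible l' s → (Preterm.sym f : Preterm F V [] γ).IsPrefix s → ti.IsArg s →
      t.IsVacuousAbs ti → Accessible l' t
  | proj {α β γ : SimpleType B} (y : V γ) (s : Preterm F V [] α) (t : Preterm F V [] β) :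
      Accessible l' s → (Preterm.fvar y : Preterm F V [] γ).IsPrefix s → t.IsArg s →
      (∀ (ε : SimpleType B) (u : Preterm F V [] ε), u.IsArg s → (⟨γ, y⟩ : Σ γ, V γ) ∉ u.fv) →
      (⟨γ, y⟩ : Σ γ, V γ) ∉ l'.fv → Accessible l' t

/-- `l.Safe u`: `u` is one of the safe subterms of `l`. -/
def Safe {α β : SimpleType B} (l : Preterm F V [] α) (u : Preterm F V [] β) : Prop :=
  ∃ (δ : SimpleType B) (l' : Preterm F V [] δ) (t : Preterm F V [] β),
    l'.IsArg l ∧ l'.Accessible t ∧ t.fv ⊆ l'.fv ∧ u = nf t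

/-- Change of signature. -/
def map {G : SimpleType B → Type x} (g : ∀ α, F α → G α) :
    ∀ {Γ : List (SimpleType B)} {α : SimpleType B}, Preterm F V Γ α → Preterm G V Γ α
  | _, _, .fvar y => .fvar y
  | _, _, .bvar i => .bvar i
  | _, _, .sym f => .sym (g _ f)
  | _, _, .lam s => .lam (s.map g)
  | _, _, .app s t => .app (s.map g) (t.map g)

end Preterm

/-- A substitution: a type-preserving map from variables to terms with finite domain
`{y | y↓ ≠ θ(y)}`. Its values may contain the bound variables of a context `Γ`, in which an instance
is placed; the substitutions in the usual sense are those with `Γ = []`. -/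
structure TermSubst {B : Type u} (F : SimpleType B → Type v) (V : SimpleType B → Type w)
    (Γ : List (SimpleType B)) where
  toFun : ∀ γ, V γ → Preterm F V Γ γ
  isTerm : ∀ (γ : SimpleType B) (y : V γ), (toFun γ y).IsTerm
  finite_dom : {y : Σ γ, V γ | Preterm.nf (Preterm.fvar y.2) ≠ toFun y.1 y.2}.Finite

namespace Preterm

variable {B : Type u} {F : SimpleType B → Type v} {V : SimpleType B → Type w}

/-- `tθ↓`. -/
noncomputable def instNf {Γ : List (SimpleType B)} {α : SimpleType B} (t : Preterm F V [] α)
    (θ : TermSubst F V Γ) : Preterm F V Γ α :=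
  nf (t.bind θ.toFun (fun _ i => nomatch i))

/-- The rewrite relation of a set `R` of rules of basic type: a subterm `lθ↓` is replaced, in any
context, by `rθ↓`. (The hole has basic type, so on terms the closure under the preterm constructors
is the closure under contexts.) -/
inductive Step (R : ∀ ⦃b : B⦄, Preterm F V [] (SimpleType.base b) →
      Preterm F V [] (SimpleType.base b) → Prop) :
    ∀ {Γ : List (SimpleType B)} {α : SimpleType B}, Preterm F V Γ α → Preterm F V Γ α → Prop
  | root {Γ : List (SimpleType B)} {b : B} {l r : Preterm F V [] (SimpleType.base b)}
      (h : R l r) (θ : TermSubst F V Γ) : Step R (l.instNf θ) (r.instNf θ)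
  | lam {Γ : List (SimpleType B)} {α β : SimpleType B} {s t : Preterm F V (α :: Γ) β} :
      Step R s t → Step R (.lam s) (.lam t)
  | appFun {Γ : List (SimpleType B)} {α β : SimpleType B}
      {s s' : Preterm F V Γ (SimpleType.arr α β)} {t : Preterm F V Γ α} :
      Step R s s' → Step R (.app s t) (.app s' t)
  | appArg {Γ : List (SimpleType B)} {α β : SimpleType B}
      {s : Preterm F V Γ (SimpleType.arr α β)} {t t' : Preterm F V Γ α} :
      Step R t t' → Step R (.app s t) (.app s t')

end Preterm

/-- A higher-order rewrite system: a (possibly infinite) set of rules `l → r` between terms of the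
same basic type such that the top of `l` is a function symbol and `FV(r) ⊆ FV(l)`. -/
structure HRS {B : Type u} (F : SimpleType B → Type v) (V : SimpleType B → Type w) where
  rule : ∀ ⦃b : B⦄, Preterm F V [] (SimpleType.base b) → Preterm F V [] (SimpleType.base b) → Prop
  left_isTerm : ∀ ⦃b : B⦄ ⦃l r : Preterm F V [] (SimpleType.base b)⦄, rule l r → l.IsTerm
  right_isTerm : ∀ ⦃b : B⦄ ⦃l r : Preterm F V [] (SimpleType.base b)⦄, rule l r → r.IsTerm
  left_top : ∀ ⦃b : B⦄ ⦃l r : Preterm F V [] (SimpleType.base b)⦄, rule l r →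
    ∃ (α : SimpleType B) (f : F α), (Preterm.sym f : Preterm F V [] α).IsPrefix l
  right_fv : ∀ ⦃b : B⦄ ⦃l r : Preterm F V [] (SimpleType.base b)⦄, rule l r → r.fv ⊆ l.fv

namespace HRS

variable {B : Type u} {F : SimpleType B → Type v} {V : SimpleType B → Type w}

/-- There is no infinite rewrite sequence starting from `t`. -/
def SN (R : HRS F V) {α : SimpleType B} (t : Preterm F V [] α) : Prop :=
  ¬ ∃ s : ℕ → Preterm F V [] α, s 0 = t ∧ ∀ i, Preterm.Step R.rule (s i) (s (i + 1))

/-- `R` is terminating: every term is strongly normalizing. -/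
def Terminating (R : HRS F V) : Prop :=
  ∀ (α : SimpleType B) (t : Preterm F V [] α), t.IsTerm → R.SN t

/-- Strong computability, by recursion on the type. -/
def SC (R : HRS F V) : ∀ α : SimpleType B, Preterm F V [] α → Prop
  | .base _, t => R.SN t
  | .arr α β, t => ∀ u : Preterm F V [] α, u.IsTerm → R.SC α u → R.SC β (Preterm.nf (.app t u))

/-- All arguments of `t` are strongly computable (for `t` of basic type, hence without leading
abstractions). -/
def SCArgs (R : HRS F V) {b : B} (t : Preterm F V [] (SimpleType.base b)) : Prop :=
  ∀ (α : SimpleType B) (u : Preterm F V [] α), u.IsArg t → R.SC α u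

/-- `ρ` names bound variables by distinct variables that are not free in `l`. -/
def FreshNames {Γ : List (SimpleType B)} {α : SimpleType B} (l : Preterm F V [] α)
    (ρ : ∀ γ, BVar Γ γ → V γ) : Prop :=
  (∀ γ, Function.Injective (ρ γ)) ∧ ∀ (γ : SimpleType B) (i : BVar Γ γ), ⟨γ, ρ γ i⟩ ∉ l.fv

/-- `R` is plain function-passing: for every rule `l → r` and every subterm `Z(r₁, …, rₙ)` of `r`
with `Z` free in `r`, some `Z(r₁, …, rₖ)↓` with `0 ≤ k ≤ n` is a safe subterm of `l`. The variables
bound in `r` above the subterm are given names that are not free in `l`. -/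
def PFP (R : HRS F V) : Prop :=
  ∀ (b : B) (l r : Preterm F V [] (SimpleType.base b)), R.rule l r →
    ∀ (Δ : List (SimpleType B)) (β γ : SimpleType B) (u : Preterm F V Δ β) (Z : V γ),
      r.Sub u → (Preterm.fvar Z : Preterm F V Δ γ).IsPrefix u →
      ∀ ρ : ∀ ε, BVar Δ ε → V ε, FreshNames l ρ →
        ∃ (ε : SimpleType B) (p : Preterm F V Δ ε),
          p.IsPrefix u ∧ l.Safe (Preterm.nf (p.named ρ))

/-- Defined symbols: the top symbols of the left-hand sides. -/
def Defined (R : HRS F V) {α : SimpleType B} (f : F α) : Prop :=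
  ∃ (b : B) (l r : Preterm F V [] (SimpleType.base b)),
    R.rule l r ∧ (Preterm.sym f : Preterm F V [] α).IsPrefix l

/-- The signature with a marked copy `f♯` of every defined symbol `f` added. -/
def MarkedSym (R : HRS F V) (α : SimpleType B) : Type v :=
  F α ⊕ {f : F α // R.Defined f}

/-- A preterm seen in the signature with marked symbols. -/
def embed (R : HRS F V) {Γ : List (SimpleType B)} {α : SimpleType B} (t : Preterm F V Γ α) :
    Preterm R.MarkedSym V Γ α :=
  t.map (fun _ f => Sum.inl f)

open Classical in
/-- The marked term `t♯`: it is `f♯(t₁, …, tₙ)` if `t = f(t₁, …, tₙ)` with `f` defined, and `t`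
otherwise. -/
noncomputable def mark (R : HRS F V) : ∀ {Γ : List (SimpleType B)} {α : SimpleType B},
    Preterm F V Γ α → Preterm R.MarkedSym V Γ α
  | _, _, .app s t => .app (R.mark s) (R.embed t)
  | _, _, .sym f => if h : R.Defined f then .sym (Sum.inr ⟨f, h⟩) else .sym (Sum.inl f)
  | _, _, .fvar y => R.embed (.fvar y)
  | _, _, .bvar i => R.embed (.bvar i)
  | _, _, .lam s => R.embed (.lam s)

/-- The rules of `R` over the signature with marked symbols. -/
def embedRule (R : HRS F V) ⦃b : B⦄ (l r : Preterm R.MarkedSym V [] (SimpleType.base b)) : Prop :=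
  ∃ l₀ r₀ : Preterm F V [] (SimpleType.base b), R.rule l₀ r₀ ∧ l = R.embed l₀ ∧ r = R.embed r₀

/-- `t♯θ↓`, for a substitution `θ` with unmarked values. -/
noncomputable def markInst (R : HRS F V) {α : SimpleType B} (t : Preterm F V [] α)
    (θ : TermSubst F V []) : Preterm R.MarkedSym V [] α :=
  Preterm.nf ((R.mark t).bind (fun γ y => R.embed (θ.toFun γ y)) (fun _ i => nomatch i))

/-- `R.IsSDP l v`: the pair `l♯ → v♯` is a static dependency pair of `R`. That is, there are a rule
`l → r` and a candidate subterm `λx₁ … xₘ. a(r₁, …, rₙ)` of `r`, with `x₁, …, xₘ` distinct and not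
free in `l`, such that `v = a(r₁, …, rₙ)`, `a` is defined, and no `a(r₁, …, rₖ)↓` with `0 ≤ k ≤ n`
is a safe subterm of `l`. -/
def IsSDP (R : HRS F V) {b c : B} (l : Preterm F V [] (SimpleType.base b))
    (v : Preterm F V [] (SimpleType.base c)) : Prop :=
  ∃ (r : Preterm F V [] (SimpleType.base b)) (Δ : List (SimpleType B))
    (t : Preterm F V Δ (SimpleType.base c)) (ρ : ∀ ε, BVar Δ ε → V ε)
    (α : SimpleType B) (a : F α),
    R.rule l r ∧ r.Cand t ∧ FreshNames l ρ ∧ v = t.named ρ ∧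
    R.Defined a ∧ (Preterm.sym a : Preterm F V Δ α).IsPrefix t ∧
    ∀ (ε : SimpleType B) (p : Preterm F V Δ ε), p.IsPrefix t →
      ¬ l.Safe (Preterm.nf (p.named ρ))

/-- An infinite static dependency chain `u₀♯ → v₀♯, u₁♯ → v₁♯, …` with its substitutions. Rewriting
preserves types, so `vᵢ` and `uᵢ₊₁` have the same basic type. -/
structure InfiniteChain (R : HRS F V) where
  ty : ℕ → B
  u : ∀ i, Preterm F V [] (SimpleType.base (ty i))
  v : ∀ i, Preterm F V [] (SimpleType.base (ty (i + 1)))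
  θ : ℕ → TermSubst F V []
  isSDP : ∀ i, R.IsSDP (u i) (v i)
  red : ∀ i, Relation.ReflTransGen (Preterm.Step R.embedRule)
    (R.markInst (v i) (θ i)) (R.markInst (u (i + 1)) (θ (i + 1)))
  scArgs_u : ∀ i, R.SCArgs ((u i).instNf (θ i))
  scArgs_v : ∀ i, R.SCArgs ((v i).instNf (θ i))

end HRS

namespace Preterm

variable {B : Type u} {F : SimpleType B → Type v} {V : SimpleType B → Type w}

/-! ### Renaming and substitution -/

-- The proof combines Tait's strong computability with minimal counterexamples. Call a term of basic
-- type minimal if its head is a defined symbol, its arguments are strongly computable, and it is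
-- not strongly normalizing (`Minimal`). Computability of instances is proved by structural
-- induction (`sc_nf_bind`): abstractions, heads that are bound variables and heads that are
-- undefined symbols cause no difficulty, so only free variables and defined symbols at the head can
-- obstruct it. If the free variables stay in place, the only obstruction is a minimal term, so a
-- non-terminating system has one (`exists_minimal`).
--
-- Rewriting inside the arguments of a minimal term terminates, so a reduction that stays
-- non-terminating must reach an instance `lθ` of a left-hand side, still with computable arguments,
-- whose contractum `rθ` is not strongly normalizing (`Minimal.exists_root`). The same induction is
-- then run over the candidate subterms of `r`. Where a free variable is the head, plain
-- function-passing supplies a safe prefix; safe subterms inherit computability from the arguments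
-- of `lθ` (`Safe.sc`, resting on `Accessible.sc`), and the other arguments are computable by
-- induction. A defined head with a safe prefix is treated alike. As `rθ` is not computable, some
-- candidate with defined head and no safe prefix must have a minimal instance, and it gives a
-- static dependency pair (`exists_isSDP_minimal`). Iteration produces an infinite chain
-- (`nonempty_infiniteChain`).
--
-- All this happens modulo normalization. Normal forms exist by a logical relation
-- (`exists_isTerm_conv`) and are unique because a term can be read back from its value in a
-- set-theoretic model (`IsTerm.eq_of_conv`). The same logical relation, with many-step rewriting at
-- basic types, shows that rewriting is compatible with substitution followed by normalization
-- (`Step.rel`).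

theorem liftRen_comp {Γ Δ E : List (SimpleType B)} {α : SimpleType B}
    (ρ : ∀ γ, BVar Γ γ → BVar Δ γ) (ρ' : ∀ γ, BVar Δ γ → BVar E γ) :
    (fun γ i => liftRen (α := α) ρ' γ (liftRen ρ γ i)) =
      liftRen (fun γ i => ρ' γ (ρ γ i)) := by
  funext γ i
  cases i <;> rfl

theorem ren_ren {Γ Δ E : List (SimpleType B)} {α : SimpleType B} (t : Preterm F V Γ α)
    (ρ : ∀ γ, BVar Γ γ → BVar Δ γ) (ρ' : ∀ γ, BVar Δ γ → BVar E γ) :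
    (t.ren ρ).ren ρ' = t.ren (fun γ i => ρ' γ (ρ γ i)) := by
  induction t generalizing Δ E with
  | fvar y => rfl
  | bvar i => rfl
  | sym f => rfl
  | lam s ih => simp only [ren, ih, liftRen_comp]
  | app s t ihs iht => simp only [ren, ihs, iht]

theorem wk_ren_liftRen {Γ Δ : List (SimpleType B)} {α β : SimpleType B} (t : Preterm F V Γ α)
    (ρ : ∀ γ, BVar Γ γ → BVar Δ γ) : (t.wk (β := β)).ren (liftRen ρ) = (t.ren ρ).wk := by
  simp only [wk, ren_ren, liftRen]

theorem ren_bind {Γ Δ E : List (SimpleType B)} {α : SimpleType B} (t : Preterm F V Γ α)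
    (ρ : ∀ γ, BVar Γ γ → BVar Δ γ) (θ : ∀ γ, V γ → Preterm F V E γ)
    (σ : ∀ γ, BVar Δ γ → Preterm F V E γ) :
    (t.ren ρ).bind θ σ = t.bind θ (fun γ i => σ γ (ρ γ i)) := by
  induction t generalizing Δ E with
  | fvar y => rfl
  | bvar i => rfl
  | sym f => rfl
  | lam s ih =>
    simp only [ren, bind, ih]
    congr 2
    funext γ i
    cases i <;> rfl
  | app s t ihs iht => simp only [ren, bind, ihs, iht]

theorem bind_ren {Γ Δ E : List (SimpleType B)} {α : SimpleType B} (t : Preterm F V Γ α)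
    (θ : ∀ γ, V γ → Preterm F V Δ γ) (σ : ∀ γ, BVar Γ γ → Preterm F V Δ γ)
    (ρ : ∀ γ, BVar Δ γ → BVar E γ) :
    (t.bind θ σ).ren ρ = t.bind (fun γ y => (θ γ y).ren ρ) (fun γ i => (σ γ i).ren ρ) := by
  induction t generalizing Δ E with
  | fvar y => rfl
  | bvar i => rfl
  | sym f => rfl
  | lam s ih =>
    simp only [ren, bind, ih, wk_ren_liftRen]
    congr 2
    funext γ i
    cases i
    · rfl
    · simp only [liftSub, wk_ren_liftRen]
  | app s t ihs iht => simp only [ren, bind, ihs, iht]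

theorem bind_bind {Γ Δ E : List (SimpleType B)} {α : SimpleType B} (t : Preterm F V Γ α)
    (θ : ∀ γ, V γ → Preterm F V Δ γ) (σ : ∀ γ, BVar Γ γ → Preterm F V Δ γ)
    (θ' : ∀ γ, V γ → Preterm F V E γ) (σ' : ∀ γ, BVar Δ γ → Preterm F V E γ) :
    (t.bind θ σ).bind θ' σ' =
      t.bind (fun γ y => (θ γ y).bind θ' σ') (fun γ i => (σ γ i).bind θ' σ') := by
  induction t generalizing Δ E with
  | fvar y => rfl
  | bvar i => rfl
  | sym f => rfl
  | lam s ih =>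
    simp only [bind, ih]
    congr 2
    · funext γ y
      simp only [wk, ren_bind, bind_ren, liftSub]
    · funext γ i
      cases i
      · rfl
      · simp only [wk, liftSub, ren_bind, bind_ren]
  | app s t ihs iht => simp only [bind, ihs, iht]

theorem liftSub_bvar {Γ Δ : List (SimpleType B)} {α : SimpleType B}
    (ρ : ∀ γ, BVar Γ γ → BVar Δ γ) :
    liftSub (α := α) (fun γ i => (.bvar (ρ γ i) : Preterm F V Δ γ)) =
      fun γ i => .bvar (liftRen ρ γ i) := by
  funext γ i
  cases i <;> rfl

theorem liftSub_bvar_id {Γ : List (SimpleType B)} {α : SimpleType B} :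
    liftSub (α := α) (fun γ i => (.bvar i : Preterm F V Γ γ)) = fun _ i => .bvar i := by
  funext γ i
  cases i <;> rfl

theorem ren_eq_bind {Γ Δ : List (SimpleType B)} {α : SimpleType B} (t : Preterm F V Γ α)
    (ρ : ∀ γ, BVar Γ γ → BVar Δ γ) :
    t.ren ρ = t.bind (fun _ y => .fvar y) (fun γ i => .bvar (ρ γ i)) := by
  induction t generalizing Δ with
  | fvar y => rfl
  | bvar i => rfl
  | sym f => rfl
  | lam s ih => simp only [ren, bind, ih, liftSub_bvar]; rfl
  | app s t ihs iht => simp only [ren, bind, ihs, iht]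

theorem bind_id {Γ : List (SimpleType B)} {α : SimpleType B} (t : Preterm F V Γ α) :
    t.bind (fun _ y => .fvar y) (fun _ i => .bvar i) = t := by
  induction t with
  | fvar y => rfl
  | bvar i => rfl
  | sym f => rfl
  | lam s ih =>
    simp only [bind, liftSub_bvar_id]
    exact congrArg _ ih
  | app s t ihs iht => simp only [bind, ihs, iht]

theorem ren_id {Γ : List (SimpleType B)} {α : SimpleType B} (t : Preterm F V Γ α) :
    t.ren (fun _ i => i) = t := by
  rw [ren_eq_bind, bind_id]

theorem bind_congr_fv {Γ Δ : List (SimpleType B)} {α : SimpleType B} (t : Preterm F V Γ α)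
    {θ θ' : ∀ γ, V γ → Preterm F V Δ γ} {σ σ' : ∀ γ, BVar Γ γ → Preterm F V Δ γ}
    (hθ : ∀ γ y, (⟨γ, y⟩ : Σ γ, V γ) ∈ t.fv → θ γ y = θ' γ y)
    (hσ : ∀ γ i, σ γ i = σ' γ i) : t.bind θ σ = t.bind θ' σ' := by
  obtain rfl : σ = σ' := by funext γ i; exact hσ γ i
  clear hσ
  induction t generalizing Δ with
  | fvar y => exact hθ _ _ rfl
  | bvar i => rfl
  | sym f => rfl
  | lam s ih =>
    simp only [bind]
    rw [ih]
    intro γ y h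
    rw [hθ γ y h]
  | app s t ihs iht =>
    simp only [bind]
    rw [ihs fun γ y h => hθ γ y (Or.inl h), iht fun γ y h => hθ γ y (Or.inr h)]

theorem fv_finite {Γ : List (SimpleType B)} {α : SimpleType B} (t : Preterm F V Γ α) :
    t.fv.Finite := by
  induction t with
  | fvar y => exact Set.finite_singleton _
  | bvar i => exact Set.finite_empty
  | sym f => exact Set.finite_empty
  | lam s ih => exact ih
  | app s t ihs iht => exact ihs.union iht

/-- Extension of an assignment of bound variables by `u` for the innermost one. -/
def consSub {Γ Δ : List (SimpleType B)} {α : SimpleType B} (u : Preterm F V Δ α)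
    (σ : ∀ γ, BVar Γ γ → Preterm F V Δ γ) : ∀ γ, BVar (α :: Γ) γ → Preterm F V Δ γ
  | _, .zero => u
  | _, .succ i => σ _ i

theorem wk_inst {Γ : List (SimpleType B)} {α β : SimpleType B} (t : Preterm F V Γ β)
    (u : Preterm F V Γ α) : t.wk.inst u = t := by
  simp only [wk, inst, ren_bind, headSub, bind_id]

/-- This identifies the β-reduct of an instance of an abstraction, so that inductions can replace
the reduct by an instance of the body under a longer assignment. -/
theorem bind_liftSub_inst {Γ Δ : List (SimpleType B)} {α β : SimpleType B}
    (s : Preterm F V (α :: Γ) β) (θ : ∀ γ, V γ → Preterm F V Δ γ)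
    (σ : ∀ γ, BVar Γ γ → Preterm F V Δ γ) (u : Preterm F V Δ α) :
    (s.bind (fun γ y => (θ γ y).wk) (liftSub σ)).inst u = s.bind θ (consSub u σ) := by
  rw [inst, bind_bind]
  apply bind_congr_fv
  · intro γ y _
    exact wk_inst _ _
  · intro γ i
    cases i
    · rfl
    · exact wk_inst _ _

theorem inst_ren {Γ Δ : List (SimpleType B)} {α β : SimpleType B} (s : Preterm F V (α :: Γ) β)
    (u : Preterm F V Γ α) (ρ : ∀ γ, BVar Γ γ → BVar Δ γ) :
    (s.inst u).ren ρ = (s.ren (liftRen ρ)).inst (u.ren ρ) := by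
  rw [inst, inst, bind_ren, ren_bind]
  apply bind_congr_fv
  · intro γ y _
    rfl
  · intro γ i
    cases i <;> rfl

theorem Conv.ren {Γ Δ : List (SimpleType B)} {α : SimpleType B} {s t : Preterm F V Γ α}
    (h : Conv s t) (ρ : ∀ γ, BVar Γ γ → BVar Δ γ) : Conv (s.ren ρ) (t.ren ρ) := by
  induction h generalizing Δ with
  | beta s u => rw [inst_ren]; exact .beta _ _
  | eta t =>
    simp only [Preterm.ren, wk_ren_liftRen, liftRen]
    exact .eta _
  | lam _ ih => exact .lam (ih _)
  | app _ _ ih₁ ih₂ => exact .app (ih₁ _) (ih₂ _)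
  | refl t => exact .refl _
  | symm _ ih => exact .symm (ih _)
  | trans _ _ ih₁ ih₂ => exact .trans (ih₁ _) (ih₂ _)

/-- Simultaneous induction on neutral preterms and terms. -/
theorem neutral_term_induction
    {N T : ∀ {Γ : List (SimpleType B)} {α : SimpleType B}, Preterm F V Γ α → Prop}
    (fvar : ∀ {Γ : List (SimpleType B)} {α : SimpleType B} (y : V α),
      N (.fvar y : Preterm F V Γ α))
    (bvar : ∀ {Γ : List (SimpleType B)} {α : SimpleType B} (i : BVar Γ α),
      N (.bvar i : Preterm F V Γ α))
    (sym : ∀ {Γ : List (SimpleType B)} {α : SimpleType B} (f : F α),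
      N (.sym f : Preterm F V Γ α))
    (app : ∀ {Γ : List (SimpleType B)} {α β : SimpleType B}
      {s : Preterm F V Γ (SimpleType.arr α β)} {t : Preterm F V Γ α},
      s.IsNeutral → t.IsTerm → N s → T t → N (.app s t))
    (lam : ∀ {Γ : List (SimpleType B)} {α β : SimpleType B} {s : Preterm F V (α :: Γ) β},
      s.IsTerm → T s → T (.lam s))
    (base : ∀ {Γ : List (SimpleType B)} {b : B} {t : Preterm F V Γ (SimpleType.base b)},
      t.IsNeutral → N t → T t) :
    (∀ {Γ : List (SimpleType B)} {α : SimpleType B} {t : Preterm F V Γ α}, t.IsNeutral → N t) ∧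
    (∀ {Γ : List (SimpleType B)} {α : SimpleType B} {t : Preterm F V Γ α}, t.IsTerm → T t) :=
  ⟨fun h => IsNeutral.rec (motive_1 := fun t _ => N t) (motive_2 := fun t _ => T t)
      fvar bvar sym (fun h₁ h₂ => app h₁ h₂) (fun h => lam h) (fun h => base h) h,
    fun h => IsTerm.rec (motive_1 := fun t _ => N t) (motive_2 := fun t _ => T t)
      fvar bvar sym (fun h₁ h₂ => app h₁ h₂) (fun h => lam h) (fun h => base h) h⟩
/-! ### Variable-for-variable substitutions preserve normal forms -/

/-- Variables, free or bound. -/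
def IsVar {Γ : List (SimpleType B)} {α : SimpleType B} (t : Preterm F V Γ α) : Prop :=
  (∃ y, t = .fvar y) ∨ ∃ i, t = .bvar i

theorem IsVar.liftSub {Γ Δ : List (SimpleType B)} {α : SimpleType B}
    {σ : ∀ γ, BVar Γ γ → Preterm F V Δ γ} (h : ∀ γ i, (σ γ i).IsVar) :
    ∀ γ i, (liftSub (α := α) σ γ i).IsVar := by
  intro γ i
  cases i with
  | zero => exact .inr ⟨_, rfl⟩
  | succ i =>
    rcases h γ i with ⟨y, hy⟩ | ⟨j, hj⟩
    · exact .inl ⟨y, by simp only [Preterm.liftSub, hy]; rfl⟩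
    · exact .inr ⟨.succ j, by simp only [Preterm.liftSub, hj]; rfl⟩

theorem IsVar.isNeutral {Γ : List (SimpleType B)} {α : SimpleType B} {t : Preterm F V Γ α}
    (h : t.IsVar) : t.IsNeutral := by
  rcases h with ⟨y, rfl⟩ | ⟨i, rfl⟩
  · exact .fvar y
  · exact .bvar i

/-- A variable put in the place of a variable creates no β-redex and keeps the number of arguments,
so no normalization is needed afterwards. Hence rewriting steps can be transported one for one along
such substitutions. -/
theorem isNeutral_isTerm_bind_var :
    (∀ {Γ : List (SimpleType B)} {α : SimpleType B} {t : Preterm F V Γ α}, t.IsNeutral →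
      ∀ {Δ : List (SimpleType B)} {σ : ∀ γ, BVar Γ γ → Preterm F V Δ γ},
        (∀ γ i, (σ γ i).IsVar) → (t.bind (fun _ y => .fvar y) σ).IsNeutral) ∧
    (∀ {Γ : List (SimpleType B)} {α : SimpleType B} {t : Preterm F V Γ α}, t.IsTerm →
      ∀ {Δ : List (SimpleType B)} {σ : ∀ γ, BVar Γ γ → Preterm F V Δ γ},
        (∀ γ i, (σ γ i).IsVar) → (t.bind (fun _ y => .fvar y) σ).IsTerm) := by
  apply neutral_term_induction
    (N := fun {Γ α} t => ∀ {Δ : List (SimpleType B)} {σ : ∀ γ, BVar Γ γ → Preterm F V Δ γ},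
      (∀ γ i, (σ γ i).IsVar) → (t.bind (fun _ y => .fvar y) σ).IsNeutral)
    (T := fun {Γ α} t => ∀ {Δ : List (SimpleType B)} {σ : ∀ γ, BVar Γ γ → Preterm F V Δ γ},
      (∀ γ i, (σ γ i).IsVar) → (t.bind (fun _ y => .fvar y) σ).IsTerm)
  · intro Γ α y Δ σ _; exact .fvar y
  · intro Γ α i Δ σ hσ; exact (hσ _ i).isNeutral
  · intro Γ α f Δ σ _; exact .sym f
  · intro Γ α β s t _ _ ih₁ ih₂ Δ σ hσ; exact .app (ih₁ hσ) (ih₂ hσ)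
  · intro Γ α β s _ ih Δ σ hσ; exact .lam (ih (IsVar.liftSub hσ))
  · intro Γ b t _ ih Δ σ hσ; exact .base (ih hσ)

theorem IsTerm.ren {Γ Δ : List (SimpleType B)} {α : SimpleType B} {t : Preterm F V Γ α}
    (h : t.IsTerm) (ρ : ∀ γ, BVar Γ γ → BVar Δ γ) : (t.ren ρ).IsTerm := by
  rw [ren_eq_bind]
  exact isNeutral_isTerm_bind_var.2 h fun γ i => .inr ⟨_, rfl⟩

theorem IsNeutral.ren {Γ Δ : List (SimpleType B)} {α : SimpleType B} {t : Preterm F V Γ α}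
    (h : t.IsNeutral) (ρ : ∀ γ, BVar Γ γ → BVar Δ γ) : (t.ren ρ).IsNeutral := by
  rw [ren_eq_bind]
  exact isNeutral_isTerm_bind_var.1 h fun γ i => .inr ⟨_, rfl⟩

/-! ### A set-theoretic model and uniqueness of normal forms -/

/-- Codes of normal forms, with de Bruijn levels for the bound variables. -/
inductive Code {B : Type u} (F : SimpleType B → Type v) (V : SimpleType B → Type w) :
    Type (max u v w)
  | bvar : ℕ → Code F V
  | fvar : (Σ γ, V γ) → Code F V
  | sym : (Σ γ, F γ) → Code F V
  | lam : SimpleType B → Code F V → Code F V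
  | app : SimpleType B → Code F V → Code F V → Code F V

/-- The full type structure over the depth-dependent codes. -/
def Dom (F : SimpleType B → Type v) (V : SimpleType B → Type w) :
    SimpleType B → Type (max u v w)
  | .base _ => ℕ → Code F V
  | .arr α β => Dom F V α → Dom F V β

mutual

/-- The value with a given code. -/
def reflect : ∀ α : SimpleType B, (ℕ → Code F V) → Dom F V α
  | .base _, c => c
  | .arr α β, c => fun a : Dom F V α => reflect β fun n => .app α (c n) (reify α a n)

/-- The code of the normal form with a given value. -/
def reify : ∀ α : SimpleType B, Dom F V α → ℕ → Code F V
  | .base _, c => c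
  | .arr α β, f => fun n => .lam α (reify β (f (reflect α fun _ => .bvar n)) (n + 1))

end

/-- Extension of an environment by a value for the innermost bound variable. -/
def consEnv {Γ : List (SimpleType B)} {α : SimpleType B} (a : Dom F V α)
    (e : ∀ γ, BVar Γ γ → Dom F V γ) : ∀ γ, BVar (α :: Γ) γ → Dom F V γ
  | _, .zero => a
  | _, .succ i => e _ i

/-- The value of a preterm. -/
def eval : ∀ {Γ : List (SimpleType B)} {α : SimpleType B}, Preterm F V Γ α →
    (∀ γ, V γ → Dom F V γ) → (∀ γ, BVar Γ γ → Dom F V γ) → Dom F V α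
  | _, _, .fvar y, φ, _ => φ _ y
  | _, _, .bvar i, _, e => e _ i
  | _, _, .sym f, _, _ => reflect _ fun _ => .sym ⟨_, f⟩
  | _, _, .lam s, φ, e => fun a => s.eval φ (consEnv a e)
  | _, _, .app s t, φ, e => (s.eval φ e : Dom F V _ → Dom F V _) (t.eval φ e)

theorem eval_ren {Γ Δ : List (SimpleType B)} {α : SimpleType B} (t : Preterm F V Γ α)
    (ρ : ∀ γ, BVar Γ γ → BVar Δ γ) (φ : ∀ γ, V γ → Dom F V γ) (e : ∀ γ, BVar Δ γ → Dom F V γ) :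
    (t.ren ρ).eval φ e = t.eval φ (fun γ i => e γ (ρ γ i)) := by
  induction t generalizing Δ with
  | fvar y => rfl
  | bvar i => rfl
  | sym f => rfl
  | lam s ih =>
    simp only [ren, eval, ih]
    funext a
    congr 1
    funext γ i
    cases i <;> rfl
  | app s t ihs iht => simp only [ren, eval, ihs, iht]

theorem eval_wk {Γ : List (SimpleType B)} {α β : SimpleType B} (t : Preterm F V Γ α)
    (φ : ∀ γ, V γ → Dom F V γ) (e : ∀ γ, BVar Γ γ → Dom F V γ) (a : Dom F V β) :
    t.wk.eval φ (consEnv a e) = t.eval φ e := by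
  rw [wk, eval_ren]
  rfl

theorem eval_bind {Γ Δ : List (SimpleType B)} {α : SimpleType B} (t : Preterm F V Γ α)
    (θ : ∀ γ, V γ → Preterm F V Δ γ) (σ : ∀ γ, BVar Γ γ → Preterm F V Δ γ)
    (φ : ∀ γ, V γ → Dom F V γ) (e : ∀ γ, BVar Δ γ → Dom F V γ) :
    (t.bind θ σ).eval φ e =
      t.eval (fun γ y => (θ γ y).eval φ e) (fun γ i => (σ γ i).eval φ e) := by
  induction t generalizing Δ with
  | fvar y => rfl
  | bvar i => rfl
  | sym f => rfl
  | lam s ih =>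
    simp only [bind, eval, ih, eval_wk]
    funext a
    congr 1
    funext γ i
    cases i
    · rfl
    · exact eval_wk _ _ _ _
  | app s t ihs iht => simp only [bind, eval, ihs, iht]

theorem eval_inst {Γ : List (SimpleType B)} {α β : SimpleType B} (s : Preterm F V (α :: Γ) β)
    (u : Preterm F V Γ α) (φ : ∀ γ, V γ → Dom F V γ) (e : ∀ γ, BVar Γ γ → Dom F V γ) :
    (s.inst u).eval φ e = s.eval φ (consEnv (u.eval φ e) e) := by
  rw [inst, eval_bind]
  congr 1
  funext γ i
  cases i <;> rfl

/-- Arrow types are interpreted by full function spaces, where β is computation and η is the η-rule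
for functions. -/
theorem Conv.eval_eq {Γ : List (SimpleType B)} {α : SimpleType B} {s t : Preterm F V Γ α}
    (h : Conv s t) (φ : ∀ γ, V γ → Dom F V γ) (e : ∀ γ, BVar Γ γ → Dom F V γ) :
    s.eval φ e = t.eval φ e := by
  induction h with
  | beta s u => rw [eval_inst]; rfl
  | eta t =>
    simp only [eval, eval_wk]
    rfl
  | lam _ ih => exact funext fun a => ih _
  | app _ _ ih₁ ih₂ => simp only [eval, ih₁, ih₂]
  | refl t => rfl
  | symm _ ih => exact (ih _).symm
  | trans _ _ ih₁ ih₂ => exact (ih₁ _).trans (ih₂ _)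

/-- Extension of an assignment of levels. -/
def consLev {Γ : List (SimpleType B)} {α : SimpleType B} (n : ℕ)
    (l : ∀ γ, BVar Γ γ → ℕ) : ∀ γ, BVar (α :: Γ) γ → ℕ
  | _, .zero => n
  | _, .succ i => l _ i

/-- The code of a preterm at depth `n`. -/
def code : ∀ {Γ : List (SimpleType B)} {α : SimpleType B}, Preterm F V Γ α →
    (∀ γ, BVar Γ γ → ℕ) → ℕ → Code F V
  | _, _, .fvar y, _, _ => .fvar ⟨_, y⟩
  | _, _, .bvar i, l, _ => .bvar (l _ i)
  | _, _, .sym f, _, _ => .sym ⟨_, f⟩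
  | _, _, .lam (α := α) s, l, n => .lam α (s.code (consLev n l) (n + 1))
  | _, _, .app (α := α) s t, l, n => .app α (s.code l n) (t.code l n)

/-- Normalization by evaluation: in the environment of reflected variables, a term is read back from
its value. Reading back an abstraction at depth `n` feeds it the variable of level `n`, which is the
level that `code` gives to that binder. -/
theorem eval_reflect :
    (∀ {Γ : List (SimpleType B)} {α : SimpleType B} {t : Preterm F V Γ α}, t.IsNeutral →
      ∀ l : ∀ γ, BVar Γ γ → ℕ, t.eval (fun γ y => reflect γ fun _ => .fvar ⟨γ, y⟩)
        (fun γ i => reflect γ fun _ => .bvar (l γ i)) = reflect α (t.code l)) ∧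
    (∀ {Γ : List (SimpleType B)} {α : SimpleType B} {t : Preterm F V Γ α}, t.IsTerm →
      ∀ l : ∀ γ, BVar Γ γ → ℕ, reify α (t.eval (fun γ y => reflect γ fun _ => .fvar ⟨γ, y⟩)
        (fun γ i => reflect γ fun _ => .bvar (l γ i))) = t.code l) := by
  apply neutral_term_induction
    (N := fun {Γ α} t => ∀ l : ∀ γ, BVar Γ γ → ℕ,
      t.eval (fun γ y => reflect γ fun _ => .fvar ⟨γ, y⟩)
        (fun γ i => reflect γ fun _ => .bvar (l γ i)) = reflect α (t.code l))
    (T := fun {Γ α} t => ∀ l : ∀ γ, BVar Γ γ → ℕ,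
      reify α (t.eval (fun γ y => reflect γ fun _ => .fvar ⟨γ, y⟩)
        (fun γ i => reflect γ fun _ => .bvar (l γ i))) = t.code l)
  · intros; rfl
  · intros; rfl
  · intros; rfl
  · intro Γ α β s t _ _ ih₁ ih₂ l
    simp only [eval, ih₁ l, code, reflect, ih₂ l]
  · intro Γ α β s _ ih l
    funext n
    simp only [reify, eval, code]
    rw [← ih]
    congr 3
    funext γ i
    cases i <;> rfl
  · intro Γ b t _ ih l
    rw [ih l]
    simp only [reflect, reify]

/-- Levels of distinct bound variables differ and lie below the depth, so the level of a new binder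
is never already taken. Codes also record enough types to recover the type of the preterm, which is
why the two sides may start with different types. -/
theorem eq_of_code_eq {Γ : List (SimpleType B)} {α α' : SimpleType B} {s : Preterm F V Γ α}
    {t : Preterm F V Γ α'} {l : ∀ γ, BVar Γ γ → ℕ} {n : ℕ} (hlt : ∀ γ i, l γ i < n)
    (hl : ∀ γ γ' i i', l γ i = l γ' i' → (⟨γ, i⟩ : Σ γ, BVar Γ γ) = ⟨γ', i'⟩)
    (h : s.code l n = t.code l n) :
    (⟨α, s⟩ : Σ α, Preterm F V Γ α) = ⟨α', t⟩ := by
  induction s generalizing α' n with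
  | fvar y =>
    cases t <;> simp only [code, reduceCtorEq, Code.fvar.injEq] at h
    cases h; rfl
  | bvar i =>
    cases t <;> simp only [code, reduceCtorEq, Code.bvar.injEq] at h
    cases hl _ _ _ _ h; rfl
  | sym f =>
    cases t <;> simp only [code, reduceCtorEq, Code.sym.injEq] at h
    cases h; rfl
  | lam s ih =>
    cases t <;> simp only [code, reduceCtorEq, Code.lam.injEq] at h
    obtain ⟨rfl, h⟩ := h
    cases ih (by
        intro γ i
        cases i
        · exact Nat.lt_succ_self n
        · exact Nat.lt_succ_of_lt (hlt _ _))
      (by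
        intro γ γ' i i' e
        cases i <;> cases i'
        · rfl
        · exact absurd e (hlt _ _).ne'
        · exact absurd e (hlt _ _).ne
        · cases hl _ _ _ _ e; rfl) h
    rfl
  | app s u ihs ihu =>
    cases t <;> simp only [code, reduceCtorEq, Code.app.injEq] at h
    obtain ⟨rfl, h₁, h₂⟩ := h
    cases ihs hlt hl h₁
    cases ihu hlt hl h₂
    rfl

/-- The de Bruijn levels of the variables of a binding context. -/
def level : ∀ {Γ : List (SimpleType B)} (γ : SimpleType B), BVar Γ γ → ℕ
  | _ :: Γ, _, .zero => Γ.length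
  | _, _, .succ i => level _ i

theorem level_lt : ∀ {Γ : List (SimpleType B)} (γ : SimpleType B) (i : BVar Γ γ),
    level γ i < Γ.length
  | _ :: _, _, .zero => Nat.lt_succ_self _
  | _, _, .succ i => Nat.lt_succ_of_lt (level_lt _ i)

theorem level_inj : ∀ {Γ : List (SimpleType B)} (γ γ' : SimpleType B) (i : BVar Γ γ)
    (i' : BVar Γ γ'), level γ i = level γ' i' → (⟨γ, i⟩ : Σ γ, BVar Γ γ) = ⟨γ', i'⟩
  | _, _, _, .zero, .zero, _ => rfl
  | _, _, _, .zero, .succ i', h => absurd h (level_lt _ i').ne'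
  | _, _, _, .succ i, .zero, h => absurd h (level_lt _ i).ne
  | _, _, _, .succ i, .succ i', h => by cases level_inj _ _ i i' h; rfl

theorem IsTerm.eq_of_eval_eq {Γ : List (SimpleType B)} {α : SimpleType B}
    {s t : Preterm F V Γ α} (hs : s.IsTerm) (ht : t.IsTerm)
    (h : ∀ φ e, s.eval φ e = t.eval φ e) : s = t := by
  have e : s.code level = t.code level := by
    rw [← eval_reflect.2 hs, ← eval_reflect.2 ht, h]
  cases eq_of_code_eq level_lt level_inj (congrFun e Γ.length)
  rfl

theorem IsTerm.eq_of_conv {Γ : List (SimpleType B)} {α : SimpleType B}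
    {s t : Preterm F V Γ α} (hs : s.IsTerm) (ht : t.IsTerm) (h : Conv s t) : s = t :=
  hs.eq_of_eval_eq ht h.eval_eq

/-! ### Logical relations and existence of normal forms -/

/-- Relations on terms that are reflexive and compatible with the term constructors and with
renaming. -/
structure Congruence
    (S : ∀ {Γ : List (SimpleType B)} {α : SimpleType B}, Preterm F V Γ α → Preterm F V Γ α → Prop) :
    Prop where
  refl : ∀ {Γ : List (SimpleType B)} {α : SimpleType B} (t : Preterm F V Γ α), S t t
  lam : ∀ {Γ : List (SimpleType B)} {α β : SimpleType B} {s t : Preterm F V (α :: Γ) β},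
    S s t → S (.lam s) (.lam t)
  app : ∀ {Γ : List (SimpleType B)} {α β : SimpleType B}
    {s s' : Preterm F V Γ (SimpleType.arr α β)} {t t' : Preterm F V Γ α},
    S s s' → S t t' → S (.app s t) (.app s' t')
  ren : ∀ {Γ Δ : List (SimpleType B)} {α : SimpleType B} {s t : Preterm F V Γ α}
    (ρ : ∀ γ, BVar Γ γ → BVar Δ γ), S s t → S (s.ren ρ) (t.ren ρ)

/-- The logical relation that relates preterms of basic type whose normal forms are related
by `S`. -/
def Rel (S : ∀ {Γ : List (SimpleType B)} {α : SimpleType B},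
      Preterm F V Γ α → Preterm F V Γ α → Prop) :
    ∀ (α : SimpleType B) {Γ : List (SimpleType B)}, Preterm F V Γ α → Preterm F V Γ α → Prop
  | .base _, _, t, t' => ∃ n n', n.IsTerm ∧ n'.IsTerm ∧ Conv t n ∧ Conv t' n' ∧ S n n'
  | .arr α β, Γ, t, t' => ∀ (Δ : List (SimpleType B)) (ρ : ∀ γ, BVar Γ γ → BVar Δ γ)
      (u u' : Preterm F V Δ α), Rel S α u u' → Rel S β (.app (t.ren ρ) u) (.app (t'.ren ρ) u')

variable {S : ∀ {Γ : List (SimpleType B)} {α : SimpleType B},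
      Preterm F V Γ α → Preterm F V Γ α → Prop}

theorem Rel.conv {Γ : List (SimpleType B)} {α : SimpleType B} {s s' t t' : Preterm F V Γ α}
    (h : Rel S α s s') (hs : Conv t s) (hs' : Conv t' s') : Rel S α t t' := by
  induction α generalizing Γ with
  | base b =>
    obtain ⟨n, n', hn, hn', hc, hc', hS⟩ := h
    exact ⟨n, n', hn, hn', hs.trans hc, hs'.trans hc', hS⟩
  | arr α β _ ih =>
    intro Δ ρ u u' hu
    exact ih (h Δ ρ u u' hu) (.app (hs.ren ρ) (.refl _)) (.app (hs'.ren ρ) (.refl _))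

theorem Rel.ren (hS : Congruence S) {Γ Δ : List (SimpleType B)} {α : SimpleType B}
    {s s' : Preterm F V Γ α} (h : Rel S α s s') (ρ : ∀ γ, BVar Γ γ → BVar Δ γ) :
    Rel S α (s.ren ρ) (s'.ren ρ) := by
  cases α with
  | base b =>
    obtain ⟨n, n', hn, hn', hc, hc', h⟩ := h
    exact ⟨n.ren ρ, n'.ren ρ, hn.ren ρ, hn'.ren ρ, hc.ren ρ, hc'.ren ρ, hS.ren ρ h⟩
  | arr α β =>
    intro E ρ' u u' hu
    rw [ren_ren, ren_ren]
    exact h E _ u u' hu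

/-- Both halves need each other at smaller types. A neutral function stays neutral when applied to
the normal form of its argument; conversely, a related pair of functions is applied to a new bound
variable, normalized and η-expanded. -/
theorem Rel.reflect_reify (hS : Congruence S) (α : SimpleType B) :
    (∀ {Γ : List (SimpleType B)} {n n' : Preterm F V Γ α}, n.IsNeutral → n'.IsNeutral →
      S n n' → Rel S α n n') ∧
    (∀ {Γ : List (SimpleType B)} {t t' : Preterm F V Γ α}, Rel S α t t' →
      ∃ n n', n.IsTerm ∧ n'.IsTerm ∧ Conv t n ∧ Conv t' n' ∧ S n n') := by
  induction α with
  | base b =>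
    exact ⟨fun hn hn' h => ⟨_, _, .base hn, .base hn', .refl _, .refl _, h⟩, fun h => h⟩
  | arr α β ihα ihβ =>
    constructor
    · intro Γ n n' hn hn' h Δ ρ u u' hu
      obtain ⟨m, m', hm, hm', hc, hc', h'⟩ := ihα.2 hu
      exact (ihβ.1 (.app (hn.ren ρ) hm) (.app (hn'.ren ρ) hm') (hS.app (hS.ren ρ h) h')).conv
        (.app (.refl _) hc) (.app (.refl _) hc')
    · intro Γ t t' h
      obtain ⟨n, n', hn, hn', hc, hc', h'⟩ := ihβ.2 (h (α :: Γ) (fun _ i => .succ i) (.bvar .zero)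
        (.bvar .zero) (ihα.1 (.bvar _) (.bvar _) (hS.refl _)))
      exact ⟨.lam n, .lam n', .lam hn, .lam hn', (Conv.eta t).symm.trans (.lam hc),
        (Conv.eta t').symm.trans (.lam hc'), hS.lam h'⟩

theorem conv_app_lam_bind_ren {Γ Δ E : List (SimpleType B)} {α β : SimpleType B}
    (s : Preterm F V (α :: Γ) β) (θ : ∀ γ, V γ → Preterm F V Δ γ)
    (σ : ∀ γ, BVar Γ γ → Preterm F V Δ γ) (ρ : ∀ γ, BVar Δ γ → BVar E γ) (u : Preterm F V E α) :
    Conv (.app (((Preterm.lam s).bind θ σ).ren ρ) u)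
      (s.bind (fun γ y => (θ γ y).ren ρ) (consSub u fun γ i => (σ γ i).ren ρ)) := by
  rw [bind_ren, ← bind_liftSub_inst]
  exact .beta _ _

theorem Rel.consSub (hS : Congruence S) {Γ Δ E : List (SimpleType B)} {α : SimpleType B}
    {u u' : Preterm F V E α} {σ σ' : ∀ γ, BVar Γ γ → Preterm F V Δ γ}
    (hu : Rel S α u u') (hσ : ∀ γ i, Rel S γ (σ γ i) (σ' γ i)) (ρ : ∀ γ, BVar Δ γ → BVar E γ) :
    ∀ γ i, Rel S γ (Preterm.consSub u (fun γ i => (σ γ i).ren ρ) γ i)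
      (Preterm.consSub u' (fun γ i => (σ' γ i).ren ρ) γ i) := by
  intro γ i
  cases i
  · exact hu
  · exact (hσ _ _).ren hS ρ

/-- The fundamental lemma of the logical relation. Under an abstraction the argument becomes the
value of the new bound variable, and `Rel.conv` absorbs the β-step. -/
theorem Rel.bind (hS : Congruence S) {Γ Δ : List (SimpleType B)} {α : SimpleType B}
    (t : Preterm F V Γ α) {θ θ' : ∀ γ, V γ → Preterm F V Δ γ}
    {σ σ' : ∀ γ, BVar Γ γ → Preterm F V Δ γ} (hθ : ∀ γ y, Rel S γ (θ γ y) (θ' γ y))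
    (hσ : ∀ γ i, Rel S γ (σ γ i) (σ' γ i)) : Rel S α (t.bind θ σ) (t.bind θ' σ') := by
  induction t generalizing Δ with
  | fvar y => exact hθ _ y
  | bvar i => exact hσ _ i
  | sym f => exact (Rel.reflect_reify hS _).1 (.sym f) (.sym f) (hS.refl _)
  | lam s ih =>
    intro E ρ u u' hu
    exact (ih (fun γ y => (hθ γ y).ren hS ρ) (Rel.consSub hS hu hσ ρ)).conv
      (conv_app_lam_bind_ren ..) (conv_app_lam_bind_ren ..)
  | app s t ihs iht =>
    have := ihs hθ hσ Δ (fun _ i => i) _ _ (iht hθ hσ)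
    rwa [ren_id, ren_id] at this

theorem Rel.refl (hS : Congruence S) {Γ : List (SimpleType B)} {α : SimpleType B}
    (t : Preterm F V Γ α) : Rel S α t t := by
  have := Rel.bind hS t (θ := fun _ y => .fvar y) (θ' := fun _ y => .fvar y)
    (fun γ y => (Rel.reflect_reify hS _).1 (.fvar y) (.fvar y) (hS.refl _))
    (σ := fun _ i => .bvar i) (σ' := fun _ i => .bvar i)
    (fun γ i => (Rel.reflect_reify hS _).1 (.bvar i) (.bvar i) (hS.refl _))
  rwa [bind_id] at this

theorem exists_isTerm_conv {Γ : List (SimpleType B)} {α : SimpleType B} (t : Preterm F V Γ α) :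
    ∃ n : Preterm F V Γ α, n.IsTerm ∧ Conv t n := by
  -- With the trivial relation, `Rel` says only that normal forms exist.
  have hS : Congruence (F := F) (V := V) (fun _ _ => True) :=
    ⟨fun _ => trivial, fun _ => trivial, fun _ _ => trivial, fun _ _ => trivial⟩
  obtain ⟨n, _, hn, _, hc, _⟩ := (Rel.reflect_reify hS α).2 (Rel.refl hS t)
  exact ⟨n, hn, hc⟩

/-! ### Normal forms -/

theorem isTerm_nf {Γ : List (SimpleType B)} {α : SimpleType B} (t : Preterm F V Γ α) :
    (nf t).IsTerm := by
  rw [nf, dif_pos (exists_isTerm_conv t)]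
  exact (exists_isTerm_conv t).choose_spec.1

theorem conv_nf {Γ : List (SimpleType B)} {α : SimpleType B} (t : Preterm F V Γ α) :
    Conv t (nf t) := by
  rw [nf, dif_pos (exists_isTerm_conv t)]
  exact (exists_isTerm_conv t).choose_spec.2

theorem eval_nf {Γ : List (SimpleType B)} {α : SimpleType B} (t : Preterm F V Γ α)
    (φ : ∀ γ, V γ → Dom F V γ) (e : ∀ γ, BVar Γ γ → Dom F V γ) :
    (nf t).eval φ e = t.eval φ e :=
  ((conv_nf t).eval_eq φ e).symm

theorem nf_eq_of_eval_eq {Γ : List (SimpleType B)} {α : SimpleType B} {s t : Preterm F V Γ α}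
    (h : ∀ φ e, s.eval φ e = t.eval φ e) : nf s = nf t :=
  (isTerm_nf s).eq_of_eval_eq (isTerm_nf t) fun φ e => by rw [eval_nf, eval_nf, h]

theorem nf_eq_of_conv {Γ : List (SimpleType B)} {α : SimpleType B} {s t : Preterm F V Γ α}
    (h : Conv s t) : nf s = nf t :=
  nf_eq_of_eval_eq h.eval_eq

theorem IsTerm.nf_eq {Γ : List (SimpleType B)} {α : SimpleType B} {t : Preterm F V Γ α}
    (h : t.IsTerm) : nf t = t :=
  (isTerm_nf t).eq_of_conv h (conv_nf t).symm

theorem nf_nf {Γ : List (SimpleType B)} {α : SimpleType B} (t : Preterm F V Γ α) :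
    nf (nf t) = nf t :=
  (isTerm_nf t).nf_eq

theorem IsTerm.nf_eq_of_conv {Γ : List (SimpleType B)} {α : SimpleType B}
    {s t : Preterm F V Γ α} (ht : t.IsTerm) (h : Conv s t) : nf s = t :=
  (Preterm.nf_eq_of_conv h).trans ht.nf_eq

/-- Completeness of the model: equal values have equal normal forms. Closure properties of
conversion can thus be checked semantically instead of by induction on derivations. -/
theorem conv_of_eval_eq {Γ : List (SimpleType B)} {α : SimpleType B} {s t : Preterm F V Γ α}
    (h : ∀ φ e, s.eval φ e = t.eval φ e) : Conv s t :=
  (conv_nf s).trans (nf_eq_of_eval_eq h ▸ (conv_nf t).symm)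

theorem Conv.bind {Γ Δ : List (SimpleType B)} {α : SimpleType B} {s t : Preterm F V Γ α}
    (h : Conv s t) (θ : ∀ γ, V γ → Preterm F V Δ γ) (σ : ∀ γ, BVar Γ γ → Preterm F V Δ γ) :
    Conv (s.bind θ σ) (t.bind θ σ) :=
  conv_of_eval_eq fun φ e => by rw [eval_bind, eval_bind, h.eval_eq]

theorem nf_lam {Γ : List (SimpleType B)} {α β : SimpleType B} (s : Preterm F V (α :: Γ) β) :
    nf (.lam s) = .lam (nf s) :=
  (IsTerm.lam (isTerm_nf s)).nf_eq_of_conv (.lam (conv_nf s))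

theorem nf_app_nf {Γ : List (SimpleType B)} {α β : SimpleType B}
    (s : Preterm F V Γ (SimpleType.arr α β)) (t : Preterm F V Γ α) :
    nf (.app (nf s) (nf t)) = nf (.app s t) :=
  nf_eq_of_conv (.app (conv_nf s).symm (conv_nf t).symm)

theorem nf_app_nf_left {Γ : List (SimpleType B)} {α β : SimpleType B}
    (s : Preterm F V Γ (SimpleType.arr α β)) (t : Preterm F V Γ α) :
    nf (.app (nf s) t) = nf (.app s t) :=
  nf_eq_of_conv (.app (conv_nf s).symm (.refl t))

theorem nf_bind_nf {Γ Δ : List (SimpleType B)} {α : SimpleType B} (t : Preterm F V Γ α)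
    (θ : ∀ γ, V γ → Preterm F V Δ γ) (σ : ∀ γ, BVar Γ γ → Preterm F V Δ γ) :
    nf ((nf t).bind θ σ) = nf (t.bind θ σ) :=
  nf_eq_of_conv ((conv_nf t).symm.bind θ σ)

theorem nf_bind_var {Γ Δ : List (SimpleType B)} {α : SimpleType B} (t : Preterm F V Γ α)
    {σ : ∀ γ, BVar Γ γ → Preterm F V Δ γ} (hσ : ∀ γ i, (σ γ i).IsVar) :
    nf (t.bind (fun _ y => .fvar y) σ) = (nf t).bind (fun _ y => .fvar y) σ :=
  (isNeutral_isTerm_bind_var.2 (isTerm_nf t) hσ).nf_eq_of_conv ((conv_nf t).bind _ _)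

theorem nf_ren {Γ Δ : List (SimpleType B)} {α : SimpleType B} (t : Preterm F V Γ α)
    (ρ : ∀ γ, BVar Γ γ → BVar Δ γ) : nf (t.ren ρ) = (nf t).ren ρ :=
  ((isTerm_nf t).ren ρ).nf_eq_of_conv ((conv_nf t).ren ρ)

theorem isNeutral_of_isTerm {Γ : List (SimpleType B)} {b : B}
    {t : Preterm F V Γ (SimpleType.base b)} (h : t.IsTerm) : t.IsNeutral := by
  cases h
  assumption

end Preterm

open Relation

namespace Preterm

variable {B : Type u} {F : SimpleType B → Type v} {V : SimpleType B → Type w}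

/-! ### Heads, prefixes and arguments -/

/-- Variables and function symbols. -/
def IsAtom {Γ : List (SimpleType B)} {α : SimpleType B} (t : Preterm F V Γ α) : Prop :=
  t.IsVar ∨ ∃ f, t = .sym f

theorem isAtom_sym {Γ : List (SimpleType B)} {α : SimpleType B} (f : F α) :
    (Preterm.sym f : Preterm F V Γ α).IsAtom :=
  .inr ⟨f, rfl⟩

theorem isAtom_fvar {Γ : List (SimpleType B)} {α : SimpleType B} (y : V α) :
    (Preterm.fvar y : Preterm F V Γ α).IsAtom :=
  .inl (.inl ⟨y, rfl⟩)

theorem IsAtom.ne_app {Γ : List (SimpleType B)} {α β : SimpleType B} {t : Preterm F V Γ β}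
    (h : t.IsAtom) (p : Preterm F V Γ (SimpleType.arr α β)) (u : Preterm F V Γ α) :
    t ≠ .app p u := by
  rcases h with (⟨y, rfl⟩ | ⟨i, rfl⟩) | ⟨f, rfl⟩ <;> exact nofun

theorem IsAtom.isNeutral {Γ : List (SimpleType B)} {α : SimpleType B} {t : Preterm F V Γ α}
    (h : t.IsAtom) : t.IsNeutral := by
  rcases h with h | ⟨f, rfl⟩
  · exact h.isNeutral
  · exact .sym f

theorem IsPrefix.eq_or_of_app {Γ : List (SimpleType B)} {α β δ : SimpleType B}
    {p : Preterm F V Γ δ} {s : Preterm F V Γ (SimpleType.arr α β)} {t : Preterm F V Γ α}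
    (h : p.IsPrefix (.app s t)) :
    (⟨δ, p⟩ : Σ δ, Preterm F V Γ δ) = ⟨β, .app s t⟩ ∨ p.IsPrefix s := by
  cases h with
  | refl => exact .inl rfl
  | app h => exact .inr h

theorem IsAtom.isPrefix_app {Γ : List (SimpleType B)} {α β δ : SimpleType B}
    {p : Preterm F V Γ δ} {s : Preterm F V Γ (SimpleType.arr α β)} {t : Preterm F V Γ α}
    (hp : p.IsAtom) (h : p.IsPrefix (.app s t)) : p.IsPrefix s := by
  rcases h.eq_or_of_app with h | h
  · cases h
    exact absurd rfl (hp.ne_app _ _)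
  · exact h

theorem IsAtom.isPrefix_of_isPrefix {Γ : List (SimpleType B)} {α β γ δ : SimpleType B}
    {h : Preterm F V Γ δ} {p : Preterm F V Γ (SimpleType.arr α β)} {u : Preterm F V Γ α}
    {t : Preterm F V Γ γ} (ha : h.IsAtom) (ht : h.IsPrefix t)
    (hp : (Preterm.app p u).IsPrefix t) : h.IsPrefix p := by
  induction hp with
  | refl => exact ha.isPrefix_app ht
  | app _ ih => exact ih (ha.isPrefix_app ht)

theorem isArg_app_right {Γ : List (SimpleType B)} {α β : SimpleType B}
    (s : Preterm F V Γ (SimpleType.arr α β)) (t : Preterm F V Γ α) : t.IsArg (.app s t) :=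
  ⟨β, s, .refl⟩

theorem IsArg.app_left {Γ : List (SimpleType B)} {α β δ : SimpleType B} {u : Preterm F V Γ δ}
    {s : Preterm F V Γ (SimpleType.arr α β)} (h : u.IsArg s) (t : Preterm F V Γ α) :
    u.IsArg (.app s t) :=
  let ⟨γ, p, hp⟩ := h
  ⟨γ, p, .app hp⟩

theorem IsArg.eq_or_of_app {Γ : List (SimpleType B)} {α β δ : SimpleType B} {u : Preterm F V Γ δ}
    {s : Preterm F V Γ (SimpleType.arr α β)} {t : Preterm F V Γ α} (h : u.IsArg (.app s t)) :
    (⟨δ, u⟩ : Σ δ, Preterm F V Γ δ) = ⟨α, t⟩ ∨ u.IsArg s := by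
  obtain ⟨γ, p, hp⟩ := h
  rcases hp.eq_or_of_app with h | h
  · cases h
    exact .inl rfl
  · exact .inr ⟨γ, p, h⟩

theorem IsAtom.not_isArg {Γ : List (SimpleType B)} {α δ : SimpleType B} {u : Preterm F V Γ δ}
    {t : Preterm F V Γ α} (ht : t.IsAtom) : ¬ u.IsArg t := by
  rintro ⟨γ, p, hp⟩
  cases hp with
  | refl => exact ht.ne_app _ _ rfl
  | app _ => exact ht.ne_app _ _ rfl

theorem IsNeutral.exists_head {Γ : List (SimpleType B)} {α : SimpleType B} {t : Preterm F V Γ α}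
    (h : t.IsNeutral) : ∃ (δ : SimpleType B) (a : Preterm F V Γ δ), a.IsAtom ∧ a.IsPrefix t := by
  induction t with
  | fvar y => exact ⟨_, _, isAtom_fvar y, .refl⟩
  | bvar i => exact ⟨_, _, .inl (.inr ⟨i, rfl⟩), .refl⟩
  | sym f => exact ⟨_, _, isAtom_sym f, .refl⟩
  | lam s => cases h
  | app s t ihs _ =>
    cases h with
    | app h _ =>
      obtain ⟨δ, a, ha, hp⟩ := ihs h
      exact ⟨δ, a, ha, .app hp⟩

theorem IsNeutral.isTerm_of_isArg {Γ : List (SimpleType B)} {α δ : SimpleType B}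
    {t : Preterm F V Γ α} {u : Preterm F V Γ δ} (h : t.IsNeutral) (hu : u.IsArg t) :
    u.IsTerm := by
  induction t with
  | fvar y => exact absurd hu (isAtom_fvar y).not_isArg
  | bvar i => exact absurd hu (IsAtom.not_isArg (.inl (.inr ⟨i, rfl⟩)))
  | sym f => exact absurd hu (isAtom_sym f).not_isArg
  | lam s => cases h
  | app s t ihs _ =>
    cases h with
    | app hs ht =>
      rcases hu.eq_or_of_app with hu | hu
      · cases hu; exact ht
      · exact ihs hs hu

theorem IsTerm.isTerm_of_isArg {Γ : List (SimpleType B)} {α δ : SimpleType B}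
    {t : Preterm F V Γ α} {u : Preterm F V Γ δ} (h : t.IsTerm) (hu : u.IsArg t) :
    u.IsTerm := by
  cases h with
  | lam h =>
    obtain ⟨γ, p, hp⟩ := hu
    cases hp
  | base h => exact h.isTerm_of_isArg hu

theorem IsPrefix.bind {Γ Δ : List (SimpleType B)} {α δ : SimpleType B} {p : Preterm F V Γ δ}
    {t : Preterm F V Γ α} (h : p.IsPrefix t) (θ : ∀ γ, V γ → Preterm F V Δ γ)
    (σ : ∀ γ, BVar Γ γ → Preterm F V Δ γ) : (p.bind θ σ).IsPrefix (t.bind θ σ) := by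
  induction h with
  | refl => exact .refl
  | app _ ih => exact .app ih

theorem IsArg.bind {Γ Δ : List (SimpleType B)} {α δ : SimpleType B} {u : Preterm F V Γ δ}
    {t : Preterm F V Γ α} (h : u.IsArg t) (θ : ∀ γ, V γ → Preterm F V Δ γ)
    (σ : ∀ γ, BVar Γ γ → Preterm F V Δ γ) : (u.bind θ σ).IsArg (t.bind θ σ) :=
  let ⟨_, _, hp⟩ := h
  ⟨_, _, hp.bind θ σ⟩

/-- Arguments of an instance, when the instance of the head is an atom. -/
theorem IsArg.exists_of_bind {Γ Δ : List (SimpleType B)} {α β δ : SimpleType B}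
    {h : Preterm F V Γ δ} {t : Preterm F V Γ α} {θ : ∀ γ, V γ → Preterm F V Δ γ}
    {σ : ∀ γ, BVar Γ γ → Preterm F V Δ γ} {v : Preterm F V Δ β}
    (hh : (h.bind θ σ).IsAtom) (ht : h.IsPrefix t) (hv : v.IsArg (t.bind θ σ)) :
    ∃ u : Preterm F V Γ β, u.IsArg t ∧ v = u.bind θ σ := by
  induction ht with
  | refl => exact absurd hv hh.not_isArg
  | @app _ _ s t _ ih =>
    rcases hv.eq_or_of_app with hv | hv
    · cases hv
      exact ⟨t, isArg_app_right s t, rfl⟩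
    · obtain ⟨u, hu, e⟩ := ih hv
      exact ⟨u, hu.app_left t, e⟩

/-- Normalization of the arguments. -/
noncomputable def argNf : ∀ {Γ : List (SimpleType B)} {α : SimpleType B}, Preterm F V Γ α →
    Preterm F V Γ α
  | _, _, .app s t => .app s.argNf (nf t)
  | _, _, .fvar y => .fvar y
  | _, _, .bvar i => .bvar i
  | _, _, .sym f => .sym f
  | _, _, .lam s => .lam s

theorem IsAtom.argNf {Γ : List (SimpleType B)} {α : SimpleType B} {t : Preterm F V Γ α}
    (h : t.IsAtom) : t.argNf = t := by
  rcases h with (⟨y, rfl⟩ | ⟨i, rfl⟩) | ⟨f, rfl⟩ <;> rfl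

theorem conv_argNf {Γ : List (SimpleType B)} {α : SimpleType B} (t : Preterm F V Γ α) :
    Conv t t.argNf := by
  induction t with
  | app s t ihs _ => exact .app ihs (conv_nf t)
  | _ => exact .refl _

theorem IsPrefix.argNf {Γ : List (SimpleType B)} {α δ : SimpleType B} {a : Preterm F V Γ δ}
    {t : Preterm F V Γ α} (ha : a.IsAtom) (h : a.IsPrefix t) : a.IsPrefix t.argNf := by
  induction h with
  | refl => rw [ha.argNf]; exact .refl
  | app _ ih => exact .app ih

theorem isNeutral_argNf {Γ : List (SimpleType B)} {α δ : SimpleType B} {a : Preterm F V Γ δ}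
    {t : Preterm F V Γ α} (ha : a.IsAtom) (h : a.IsPrefix t) : t.argNf.IsNeutral := by
  induction h with
  | refl => rw [ha.argNf]; exact ha.isNeutral
  | app _ ih => exact .app ih (isTerm_nf _)

/-- An atom at the head forms no β-redex, and at basic type nothing remains to be η-expanded, so
normalization only touches the arguments. -/
theorem nf_eq_argNf {Γ : List (SimpleType B)} {b : B} {δ : SimpleType B} {a : Preterm F V Γ δ}
    {t : Preterm F V Γ (SimpleType.base b)} (ha : a.IsAtom) (h : a.IsPrefix t) :
    nf t = t.argNf :=
  (IsTerm.base (isNeutral_argNf ha h)).nf_eq_of_conv (conv_argNf t)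

theorem IsArg.argNf {Γ : List (SimpleType B)} {α δ : SimpleType B} {u : Preterm F V Γ δ}
    {t : Preterm F V Γ α} (h : u.IsArg t) : (nf u).IsArg t.argNf := by
  obtain ⟨γ, p, hp⟩ := h
  refine ⟨γ, p.argNf, ?_⟩
  induction hp with
  | refl => exact .refl
  | app _ ih => exact .app ih

theorem IsArg.exists_of_argNf {Γ : List (SimpleType B)} {α δ γ : SimpleType B}
    {a : Preterm F V Γ δ} {t : Preterm F V Γ α} {v : Preterm F V Γ γ} (ha : a.IsAtom)
    (h : a.IsPrefix t) (hv : v.IsArg t.argNf) : ∃ u : Preterm F V Γ γ, u.IsArg t ∧ v = nf u := by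
  induction h with
  | refl => rw [ha.argNf] at hv; exact absurd hv ha.not_isArg
  | @app _ _ s t _ ih =>
    rcases hv.eq_or_of_app with hv | hv
    · cases hv
      exact ⟨t, isArg_app_right s t, rfl⟩
    · obtain ⟨u, hu, e⟩ := ih hv
      exact ⟨u, hu.app_left t, e⟩

end Preterm

/-! ### Rewriting and substitution -/

open Classical in
/-- The substitution given by the normal forms of the values of `θ` on a finite set of variables. -/
noncomputable def TermSubst.restrict {B : Type u} {F : SimpleType B → Type v}
    {V : SimpleType B → Type w} {Γ : List (SimpleType B)} (A : Set (Σ γ, V γ)) (hA : A.Finite)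
    (θ : ∀ γ, V γ → Preterm F V Γ γ) : TermSubst F V Γ where
  toFun γ y := if (⟨γ, y⟩ : Σ γ, V γ) ∈ A then Preterm.nf (θ γ y) else Preterm.nf (.fvar y)
  isTerm γ y := by
    split <;> exact Preterm.isTerm_nf _
  finite_dom := by
    refine hA.subset fun y hy => ?_
    by_contra h
    exact hy (if_neg h).symm

namespace Preterm

variable {B : Type u} {F : SimpleType B → Type v} {V : SimpleType B → Type w}

theorem nf_bind_congr {Γ Δ : List (SimpleType B)} {α : SimpleType B} (t : Preterm F V Γ α)
    {θ θ' : ∀ γ, V γ → Preterm F V Δ γ} {σ σ' : ∀ γ, BVar Γ γ → Preterm F V Δ γ}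
    (hθ : ∀ γ y, (⟨γ, y⟩ : Σ γ, V γ) ∈ t.fv → nf (θ γ y) = nf (θ' γ y))
    (hσ : ∀ γ i, nf (σ γ i) = nf (σ' γ i)) : nf (t.bind θ σ) = nf (t.bind θ' σ') := by
  have key : ∀ (θ : ∀ γ, V γ → Preterm F V Δ γ) (σ : ∀ γ, BVar Γ γ → Preterm F V Δ γ),
      nf (t.bind θ σ) = nf (t.bind (fun γ y => nf (θ γ y)) (fun γ i => nf (σ γ i))) :=
    fun θ σ => nf_eq_of_eval_eq fun φ e => by simp only [eval_bind, eval_nf]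
  rw [key, key θ', bind_congr_fv t (fun γ y h => hθ γ y h) hσ]

theorem instNf_restrict {Γ : List (SimpleType B)} {α : SimpleType B} (t : Preterm F V [] α)
    {A : Set (Σ γ, V γ)} (hA : A.Finite) (θ : ∀ γ, V γ → Preterm F V Γ γ) (h : t.fv ⊆ A)
    (σ : ∀ γ, BVar [] γ → Preterm F V Γ γ) :
    t.instNf (TermSubst.restrict A hA θ) = nf (t.bind θ σ) := by
  apply nf_bind_congr
  · intro γ y hy
    simp only [TermSubst.restrict, if_pos (h hy), nf_nf]
  · exact fun _ i => nomatch i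

/-- Rewriting asks for a substitution with finite domain. Restricting `θ` to the free variables of
`l` changes neither instance, because those of `r` are among them. -/
theorem step_nf_bind (R : HRS F V) {Γ : List (SimpleType B)} {b : B}
    {l r : Preterm F V [] (SimpleType.base b)} (h : R.rule l r)
    (θ : ∀ γ, V γ → Preterm F V Γ γ) (σ : ∀ γ, BVar [] γ → Preterm F V Γ γ) :
    Step R.rule (nf (l.bind θ σ)) (nf (r.bind θ σ)) := by
  rw [← instNf_restrict l l.fv_finite θ subset_rfl, ← instNf_restrict r l.fv_finite θ (R.right_fv h)]
  exact .root h _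

theorem Step.bind_var {R : HRS F V} {Γ Δ : List (SimpleType B)} {α : SimpleType B}
    {s t : Preterm F V Γ α} (h : Step R.rule s t) {σ : ∀ γ, BVar Γ γ → Preterm F V Δ γ}
    (hσ : ∀ γ i, (σ γ i).IsVar) :
    Step R.rule (s.bind (fun _ y => .fvar y) σ) (t.bind (fun _ y => .fvar y) σ) := by
  induction h generalizing Δ with
  | root h θ =>
    rw [instNf, instNf, ← nf_bind_var _ hσ, ← nf_bind_var _ hσ, bind_bind, bind_bind]
    exact step_nf_bind R h _ _
  | lam _ ih => exact .lam (ih (IsVar.liftSub hσ))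
  | appFun _ ih => exact .appFun (ih hσ)
  | appArg _ ih => exact .appArg (ih hσ)

theorem Step.ren {R : HRS F V} {Γ Δ : List (SimpleType B)} {α : SimpleType B}
    {s t : Preterm F V Γ α} (h : Step R.rule s t) (ρ : ∀ γ, BVar Γ γ → BVar Δ γ) :
    Step R.rule (s.ren ρ) (t.ren ρ) := by
  rw [ren_eq_bind, ren_eq_bind]
  exact h.bind_var fun γ i => .inr ⟨_, rfl⟩

theorem Step.isNeutral_isTerm {R : HRS F V} {Γ : List (SimpleType B)} {α : SimpleType B}
    {s t : Preterm F V Γ α} (h : Step R.rule s t) :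
    (s.IsNeutral → t.IsNeutral) ∧ (s.IsTerm → t.IsTerm) := by
  induction h with
  | root h θ => exact ⟨fun _ => isNeutral_of_isTerm (isTerm_nf _), fun _ => isTerm_nf _⟩
  | lam _ ih =>
    refine ⟨nofun, fun h => ?_⟩
    cases h with
    | lam h => exact .lam (ih.2 h)
  | @appFun _ _ _ s s' t _ ih =>
    have key : (Preterm.app s t).IsNeutral → (Preterm.app s' t).IsNeutral := by
      rintro (_ | _ | _ | ⟨hs, ht⟩)
      exact .app (ih.1 hs) ht
    refine ⟨key, fun h => ?_⟩
    cases h with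
    | base h => exact .base (key h)
  | @appArg _ _ _ s t t' _ ih =>
    have key : (Preterm.app s t).IsNeutral → (Preterm.app s t').IsNeutral := by
      rintro (_ | _ | _ | ⟨hs, ht⟩)
      exact .app hs (ih.2 ht)
    refine ⟨key, fun h => ?_⟩
    cases h with
    | base h => exact .base (key h)

theorem congruence_steps (R : HRS F V) : Congruence (F := F) (V := V)
    (fun s t => ReflTransGen (Step R.rule) s t) where
  refl _ := .refl
  lam h := h.lift _ fun _ _ => .lam
  app h h' := (h.lift (fun s => Preterm.app s _) fun _ _ => .appFun).trans
    (h'.lift (fun t => Preterm.app _ t) fun _ _ => .appArg)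
  ren ρ h := h.lift (fun s => s.ren ρ) fun _ _ h => h.ren ρ

theorem Rel.steps_nf {R : HRS F V} {Γ : List (SimpleType B)} {α : SimpleType B}
    {s t : Preterm F V Γ α} (h : Rel (fun s t => ReflTransGen (Step R.rule) s t) α s t) :
    ReflTransGen (Step R.rule) (nf s) (nf t) := by
  obtain ⟨n, n', hn, hn', hc, hc', h⟩ := (Rel.reflect_reify (congruence_steps R) α).2 h
  rwa [hn.nf_eq_of_conv hc, hn'.nf_eq_of_conv hc']

/-- For a root step, the redex is first contracted under the substitution on the left, which takes
one step; the substitution is then rewritten inside the contractum by `Rel.bind`. The other cases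
repeat the fundamental lemma with one component replaced by the induction hypothesis. -/
theorem Step.rel {R : HRS F V} {Γ Δ : List (SimpleType B)} {α : SimpleType B}
    {s t : Preterm F V Γ α} (h : Step R.rule s t) {θ θ' : ∀ γ, V γ → Preterm F V Δ γ}
    {σ σ' : ∀ γ, BVar Γ γ → Preterm F V Δ γ}
    (hθ : ∀ γ y, Rel (fun s t => ReflTransGen (Step R.rule) s t) γ (θ γ y) (θ' γ y))
    (hσ : ∀ γ i, Rel (fun s t => ReflTransGen (Step R.rule) s t) γ (σ γ i) (σ' γ i)) :
    Rel (fun s t => ReflTransGen (Step R.rule) s t) α (s.bind θ σ) (t.bind θ' σ') := by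
  induction h generalizing Δ with
  | root h τ =>
    refine ⟨_, _, isTerm_nf _, isTerm_nf _, conv_nf _, conv_nf _, ?_⟩
    refine .head ?_ (Rel.bind (congruence_steps R) _ hθ hσ).steps_nf
    rw [instNf, instNf, nf_bind_nf, nf_bind_nf, bind_bind, bind_bind]
    exact step_nf_bind R h _ _
  | lam _ ih =>
    intro E ρ u u' hu
    exact (ih (fun γ y => (hθ γ y).ren (congruence_steps R) ρ)
      (Rel.consSub (congruence_steps R) hu hσ ρ)).conv
      (conv_app_lam_bind_ren ..) (conv_app_lam_bind_ren ..)
  | @appFun _ _ _ _ _ t _ ih =>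
    have := ih hθ hσ Δ (fun _ i => i) _ _ (Rel.bind (congruence_steps R) t hθ hσ)
    rwa [ren_id, ren_id] at this
  | @appArg _ _ _ s _ _ _ ih =>
    have : Rel _ (.arr _ _) _ _ := Rel.bind (congruence_steps R) s hθ hσ
    have := this Δ (fun _ i => i) _ _ (ih hθ hσ)
    rwa [ren_id, ren_id] at this

theorem Step.steps_nf_app {R : HRS F V} {Γ : List (SimpleType B)} {α β : SimpleType B}
    {s t : Preterm F V Γ (SimpleType.arr α β)} (h : Step R.rule s t) (u : Preterm F V Γ α) :
    ReflTransGen (Step R.rule) (nf (.app s u)) (nf (.app t u)) := by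
  have hS := congruence_steps R
  have := h.rel (θ := fun _ y => .fvar y) (θ' := fun _ y => .fvar y)
    (fun γ y => Rel.refl hS _) (σ := fun _ i => .bvar i) (σ' := fun _ i => .bvar i)
    (fun γ i => Rel.refl hS _)
  rw [bind_id, bind_id] at this
  have := this Γ (fun _ i => i) u u (Rel.refl hS _)
  rw [ren_id, ren_id] at this
  exact this.steps_nf

/-! ### Strong normalization -/

/-- Accessibility with respect to rewriting, in any binding context. -/
def StepAcc (R : HRS F V) {Γ : List (SimpleType B)} {α : SimpleType B}
    (t : Preterm F V Γ α) : Prop :=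
  Acc (fun a b => Step R.rule b a) t

theorem sn_iff_stepAcc {R : HRS F V} {α : SimpleType B} {t : Preterm F V [] α} :
    R.SN t ↔ StepAcc R t := by
  rw [HRS.SN, StepAcc, ← not_iff_not, not_not, not_acc_iff_exists_descending_chain]

theorem StepAcc.step {R : HRS F V} {Γ : List (SimpleType B)} {α : SimpleType B}
    {s t : Preterm F V Γ α} (h : StepAcc R s) (hst : Step R.rule s t) : StepAcc R t :=
  h.inv hst

theorem StepAcc.steps {R : HRS F V} {Γ : List (SimpleType B)} {α : SimpleType B}
    {s t : Preterm F V Γ α} (h : StepAcc R s) (hst : ReflTransGen (Step R.rule) s t) :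
    StepAcc R t := by
  induction hst with
  | refl => exact h
  | tail _ hst ih => exact ih.step hst

theorem StepAcc.of_map {R : HRS F V} {Γ Δ : List (SimpleType B)} {α β : SimpleType B}
    {f : Preterm F V Γ α → Preterm F V Δ β} {t : Preterm F V Γ α} (h : StepAcc R (f t))
    (hf : ∀ s s', Step R.rule s s' → Step R.rule (f s) (f s')) : StepAcc R t := by
  unfold StepAcc at h
  generalize e : f t = u at h
  induction h generalizing t with
  | intro u _ ih =>
    subst e
    exact .intro _ fun t' ht => ih _ (hf _ _ ht) rfl

theorem StepAcc.lam {R : HRS F V} {Γ : List (SimpleType B)} {α β : SimpleType B}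
    {s : Preterm F V (α :: Γ) β} (h : StepAcc R s) : StepAcc R (.lam s) := by
  unfold StepAcc at h
  induction h with
  | intro s _ ih =>
    refine .intro _ fun t ht => ?_
    cases ht with
    | lam ht => exact ih _ ht

theorem IsArg.exists_step {R : HRS F V} {Γ : List (SimpleType B)} {α β : SimpleType B}
    {u u' : Preterm F V Γ α} {t : Preterm F V Γ β} (hu : u.IsArg t) (h : Step R.rule u u') :
    ∃ t', Step R.rule t t' ∧ u'.IsArg t' := by
  obtain ⟨γ, p, hp⟩ := hu
  induction hp with
  | refl => exact ⟨_, .appArg h, isArg_app_right _ _⟩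
  | app _ ih =>
    obtain ⟨t', ht', hu'⟩ := ih
    exact ⟨_, .appFun ht', hu'.app_left _⟩

theorem Sub.exists_step {R : HRS F V} {Γ Δ : List (SimpleType B)} {α β : SimpleType B}
    {s : Preterm F V Γ α} {u u' : Preterm F V Δ β} (hs : s.Sub u) (h : Step R.rule u u') :
    ∃ s', Step R.rule s s' ∧ s'.Sub u' := by
  induction hs with
  | refl t => exact ⟨_, h, .refl _⟩
  | lam _ ih =>
    obtain ⟨s', hs', hu'⟩ := ih h
    exact ⟨_, .lam hs', .lam hu'⟩
  | arg ha _ ih =>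
    obtain ⟨s', hs', hu'⟩ := ih h
    obtain ⟨t', ht', ha'⟩ := ha.exists_step hs'
    exact ⟨t', ht', .arg ha' hu'⟩

theorem StepAcc.sub {R : HRS F V} {Γ Δ : List (SimpleType B)} {α β : SimpleType B}
    {s : Preterm F V Γ α} {u : Preterm F V Δ β} (h : StepAcc R s) (hu : s.Sub u) :
    StepAcc R u := by
  unfold StepAcc at h
  induction h generalizing u with
  | intro s _ ih =>
    refine .intro _ fun u' hu' => ?_
    obtain ⟨s', hs', hsub⟩ := hu.exists_step hu'
    exact ih s' hs' hsub

theorem IsArg.sub {Γ : List (SimpleType B)} {α β : SimpleType B} {u : Preterm F V Γ α}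
    {t : Preterm F V Γ β} (h : u.IsArg t) : t.Sub u :=
  .arg h (.refl u)

/-- Rewriting inside an argument. -/
inductive ArgStep (R : HRS F V) : ∀ {Γ : List (SimpleType B)} {α : SimpleType B},
    Preterm F V Γ α → Preterm F V Γ α → Prop
  | right {Γ : List (SimpleType B)} {α β : SimpleType B}
      {s : Preterm F V Γ (SimpleType.arr α β)} {t t' : Preterm F V Γ α} :
      Step R.rule t t' → ArgStep R (.app s t) (.app s t')
  | left {Γ : List (SimpleType B)} {α β : SimpleType B}
      {s s' : Preterm F V Γ (SimpleType.arr α β)} {t : Preterm F V Γ α} :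
      ArgStep R s s' → ArgStep R (.app s t) (.app s' t)

theorem ArgStep.isPrefix_iff {R : HRS F V} {Γ : List (SimpleType B)} {α δ : SimpleType B}
    {s t : Preterm F V Γ α} {a : Preterm F V Γ δ} (h : ArgStep R s t) (ha : a.IsAtom) :
    a.IsPrefix s ↔ a.IsPrefix t := by
  induction h with
  | right h => exact ⟨fun h => .app (ha.isPrefix_app h), fun h => .app (ha.isPrefix_app h)⟩
  | left _ ih =>
    exact ⟨fun h => .app (ih.1 (ha.isPrefix_app h)), fun h => .app (ih.2 (ha.isPrefix_app h))⟩

theorem ArgStep.exists_steps_of_isArg {R : HRS F V} {Γ : List (SimpleType B)}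
    {α δ : SimpleType B} {s t : Preterm F V Γ α} (h : ArgStep R s t) {u : Preterm F V Γ δ}
    (hu : u.IsArg t) : ∃ u', u'.IsArg s ∧ ReflTransGen (Step R.rule) u' u := by
  induction h with
  | @right _ _ s t t' h =>
    rcases hu.eq_or_of_app with hu | hu
    · cases hu
      exact ⟨t, isArg_app_right s t, .single h⟩
    · exact ⟨u, hu.app_left t, .refl⟩
  | @left _ _ s s' t _ ih =>
    rcases hu.eq_or_of_app with hu | hu
    · cases hu
      exact ⟨_, isArg_app_right _ _, .refl⟩
    · obtain ⟨u', hu', h'⟩ := ih hu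
      exact ⟨u', hu'.app_left t, h'⟩

/-- Nested induction over the function part and the last argument: each step decreases one of them
and leaves the other unchanged. -/
theorem acc_argStep {R : HRS F V} {Γ : List (SimpleType B)} {α : SimpleType B}
    (t : Preterm F V Γ α) (h : ∀ (δ : SimpleType B) (u : Preterm F V Γ δ), u.IsArg t →
      StepAcc R u) : Acc (fun a b => ArgStep R b a) t := by
  induction t with
  | app s t ihs iht =>
    have hs := ihs fun δ u hu => h δ u (hu.app_left t)
    have ht := h _ t (isArg_app_right s t)
    clear h ihs iht
    unfold StepAcc at ht
    induction hs generalizing t with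
    | intro s _ ihs =>
      induction ht with
      | intro t ht iht =>
        refine .intro _ fun t' h => ?_
        cases h with
        | right h => exact iht _ h
        | left h => exact ihs _ h t ⟨t, ht⟩
  | _ => exact .intro _ nofun

/-- Rules have basic type, so the function part of an application is never itself a redex. The
equation is stated in a sigma type in order to carry the type index. -/
theorem Step.argStep_or_root {R : HRS F V} {Γ : List (SimpleType B)} {α : SimpleType B}
    {s t : Preterm F V Γ α} (h : Step R.rule s t) (hs : s.IsNeutral) :
    ArgStep R s t ∨ ∃ (b : B) (l r : Preterm F V [] (SimpleType.base b)) (θ : TermSubst F V Γ),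
      R.rule l r ∧ (⟨α, s, t⟩ : Σ α, Preterm F V Γ α × Preterm F V Γ α) =
        ⟨.base b, l.instNf θ, r.instNf θ⟩ := by
  induction h with
  | root h θ => exact .inr ⟨_, _, _, θ, h, rfl⟩
  | lam _ _ => cases hs
  | appFun _ ih =>
    cases hs with
    | app hs _ =>
      rcases ih hs with h | ⟨b, l, r, θ, _, e⟩
      · exact .inl (.left h)
      · cases e
  | appArg h _ => exact .inl (.right h)

/-- The head is not a defined symbol. -/
def Inert (R : HRS F V) {Γ : List (SimpleType B)} {α : SimpleType B} (t : Preterm F V Γ α) :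
    Prop :=
  ∀ (δ : SimpleType B) (f : F δ), (Preterm.sym f : Preterm F V Γ δ).IsPrefix t → ¬ R.Defined f

theorem instNf_eq {Γ : List (SimpleType B)} {α : SimpleType B} (t : Preterm F V [] α)
    (θ : TermSubst F V Γ) (σ : ∀ γ, BVar [] γ → Preterm F V Γ γ) :
    t.instNf θ = nf (t.bind θ.toFun σ) :=
  congrArg nf (bind_congr_fv t (fun _ _ _ => rfl) fun _ i => nomatch i)

theorem IsPrefix.instNf_sym {Γ : List (SimpleType B)} {b : B} {δ : SimpleType B} {f : F δ}
    {t : Preterm F V [] (SimpleType.base b)} (h : (Preterm.sym f : Preterm F V [] δ).IsPrefix t)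
    (θ : TermSubst F V Γ) : (Preterm.sym f : Preterm F V Γ δ).IsPrefix (t.instNf θ) := by
  let σ : ∀ γ, BVar [] γ → Preterm F V Γ γ := fun _ i => nomatch i
  have h' : (Preterm.sym f : Preterm F V Γ δ).IsPrefix (t.bind θ.toFun σ) := h.bind _ _
  rw [instNf_eq t θ σ, nf_eq_argNf (isAtom_sym f) h']
  exact h'.argNf (isAtom_sym f)

/-- Argument steps keep the head, and a root step would need a defined symbol there, so every
reduction takes place inside the arguments. -/
theorem stepAcc_of_inert {R : HRS F V} {Γ : List (SimpleType B)} {b : B}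
    {t : Preterm F V Γ (SimpleType.base b)} (hn : t.IsNeutral) (hi : Inert R t)
    (h : ∀ (δ : SimpleType B) (u : Preterm F V Γ δ), u.IsArg t → StepAcc R u) :
    StepAcc R t := by
  have ha := acc_argStep t h
  clear h
  induction ha with
  | intro t _ ih =>
    refine .intro _ fun t' ht' => ?_
    rcases ht'.argStep_or_root hn with h | ⟨b, l, r, θ, hlr, e⟩
    · exact ih _ h (ht'.isNeutral_isTerm.1 hn)
        fun δ f hf => hi δ f ((h.isPrefix_iff (isAtom_sym f)).2 hf)
    · cases e
      obtain ⟨α, f, hf⟩ := R.left_top hlr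
      exact absurd ⟨_, l, r, hlr, hf⟩ (hi _ f (hf.instNf_sym θ))

/-! ### Strong computability -/

theorem sc_steps {R : HRS F V} {α : SimpleType B} {s t : Preterm F V [] α}
    (h : ReflTransGen (Step R.rule) s t) (hs : R.SC α s) : R.SC α t := by
  induction α with
  | base b => exact sn_iff_stepAcc.2 ((sn_iff_stepAcc.1 hs).steps h)
  | arr α β _ ih =>
    intro u hu hSC
    exact ih (h.lift' (fun s => nf (.app s u)) fun _ _ h => h.steps_nf_app u) (hs u hu hSC)

theorem sc_nf_app {R : HRS F V} {α β : SimpleType B} {s : Preterm F V [] (SimpleType.arr α β)}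
    {t : Preterm F V [] α} (hs : R.SC _ (nf s)) (ht : R.SC _ (nf t)) :
    R.SC _ (nf (.app s t)) := by
  rw [← nf_app_nf]
  exact hs _ (isTerm_nf t) ht

theorem sc_nf_arr {R : HRS F V} {α β : SimpleType B} {s : Preterm F V [] (SimpleType.arr α β)}
    (h : ∀ u : Preterm F V [] α, R.SC _ (nf u) → R.SC _ (nf (.app s u))) : R.SC _ (nf s) := by
  intro u hu hSC
  rw [nf_app_nf_left]
  exact h u (by rwa [hu.nf_eq])

/-- Tait's simultaneous induction on types. The first half uses the second to see that a newly
supplied argument is normalizing; the second uses the first to see that a variable is computable and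
may be supplied as an argument. -/
theorem sc_inert_and_stepAcc [∀ α, Infinite (V α)] (R : HRS F V) (α : SimpleType B) :
    (∀ n : Preterm F V [] α, n.IsNeutral → Inert R n →
      (∀ (δ : SimpleType B) (u : Preterm F V [] δ), u.IsArg n → StepAcc R u) →
      R.SC α (nf n)) ∧
    (∀ t : Preterm F V [] α, t.IsTerm → R.SC α t → StepAcc R t) := by
  induction α with
  | base b =>
    refine ⟨fun n hn hi h => ?_, fun t _ h => sn_iff_stepAcc.1 h⟩
    rw [(IsTerm.base hn).nf_eq]
    exact sn_iff_stepAcc.2 (stepAcc_of_inert hn hi h)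
  | arr α β ihα ihβ =>
    constructor
    · intro n hn hi h u hu hSC
      rw [nf_app_nf_left]
      refine ihβ.1 _ (.app hn hu) (fun δ f hf => hi δ f ((isAtom_sym f).isPrefix_app hf)) ?_
      intro δ v hv
      rcases hv.eq_or_of_app with hv | hv
      · cases hv
        exact ihα.2 u hu hSC
      · exact h δ v hv
    · intro t ht hSC
      cases ht with
      | @lam _ _ _ s hs =>
        -- The variable need not be fresh: every step of the body `s` is also a step of `s.inst
        -- (.fvar y)`.
        obtain ⟨y⟩ : Nonempty (V α) := inferInstance
        have hy : R.SC α (nf (.fvar y)) := ihα.1 _ (.fvar y)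
          (fun δ f hf => by cases hf) fun δ u hu => absurd hu (isAtom_fvar y).not_isArg
        have hσ : ∀ γ i, (headSub (Preterm.fvar y : Preterm F V [] α) γ i).IsVar := by
          intro γ i
          cases i
          · exact .inl ⟨y, rfl⟩
          · exact .inr ⟨_, rfl⟩
        have h := hSC _ (isTerm_nf _) hy
        have e : nf (.app (.lam s) (nf (.fvar y))) = s.inst (.fvar y) :=
          (isNeutral_isTerm_bind_var.2 hs hσ).nf_eq_of_conv
            (.trans (.app (.refl _) (conv_nf _).symm) (.beta _ _))
        rw [e] at h
        exact (StepAcc.of_map (f := fun s => s.inst (.fvar y))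
          (ihβ.2 _ (isNeutral_isTerm_bind_var.2 hs hσ) h) fun s s' h => h.bind_var hσ).lam

theorem stepAcc_of_sc [∀ α, Infinite (V α)] {R : HRS F V} {α : SimpleType B}
    {t : Preterm F V [] α} (ht : t.IsTerm) (h : R.SC α t) : StepAcc R t :=
  (sc_inert_and_stepAcc R α).2 t ht h

theorem sc_nf_fvar [∀ α, Infinite (V α)] (R : HRS F V) {α : SimpleType B} (y : V α) :
    R.SC α (nf (.fvar y)) :=
  (sc_inert_and_stepAcc R α).1 _ (.fvar y) (fun δ f hf => by cases hf)
    fun δ u hu => absurd hu (isAtom_fvar y).not_isArg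

/-- If an instance of a prefix of `t` and the instances of all arguments of `t` are strongly
computable, then so is that of `t`. -/
theorem sc_nf_of_isPrefix {R : HRS F V} {Γ : List (SimpleType B)} {α δ : SimpleType B}
    {p : Preterm F V Γ δ} {t : Preterm F V Γ α} {θ : ∀ γ, V γ → Preterm F V [] γ}
    {σ : ∀ γ, BVar Γ γ → Preterm F V [] γ} (hp : p.IsPrefix t) (h : R.SC δ (nf (p.bind θ σ)))
    (ht : ∀ (γ : SimpleType B) (u : Preterm F V Γ γ), u.IsArg t → R.SC γ (nf (u.bind θ σ))) :
    R.SC α (nf (t.bind θ σ)) := by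
  induction hp with
  | refl => exact h
  | @app _ _ s t _ ih =>
    exact sc_nf_app (ih fun γ u hu => ht γ u (hu.app_left t)) (ht _ t (isArg_app_right s t))

/-- Supplying variables as arguments reaches basic type, where the normal forms of the arguments are
visible as subterms. -/
theorem stepAcc_nf_of_isArg [∀ α, Infinite (V α)] {R : HRS F V} {α β δ : SimpleType B}
    {a : Preterm F V [] δ} {t : Preterm F V [] α} {u : Preterm F V [] β} (ha : a.IsAtom)
    (hp : a.IsPrefix t) (h : R.SC α (nf t)) (hu : u.IsArg t) : StepAcc R (nf u) := by
  induction α with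
  | base b =>
    rw [nf_eq_argNf ha hp] at h
    exact (sn_iff_stepAcc.1 h).sub hu.argNf.sub
  | arr α α' _ ih =>
    obtain ⟨y⟩ : Nonempty (V α) := inferInstance
    exact ih hp.app (sc_nf_app h (sc_nf_fvar R y)) (hu.app_left (.fvar y))

/-! ### Safe subterms -/

/-- Computability can be tested by computable contexts with values in an arbitrary fixed type. This
serves to extract an argument whose type differs from that of the term containing it, where a plain
projection would be ill-typed. -/
theorem sc_nf_of_forall_app [∀ α, Infinite (V α)] {R : HRS F V} {β ε : SimpleType B}
    {q : Preterm F V [] β} (h : ∀ c : Preterm F V [] (SimpleType.arr β ε), R.SC _ (nf c) →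
      R.SC ε (nf (.app c q))) : R.SC β (nf q) := by
  induction β with
  | base b =>
    obtain ⟨z⟩ : Nonempty (V (.arr (.base b) ε)) := inferInstance
    exact sn_iff_stepAcc.2 (stepAcc_nf_of_isArg (isAtom_fvar z) (.app .refl)
      (h _ (sc_nf_fvar R z)) (isArg_app_right _ q))
  | arr β₁ β₂ _ ih =>
    refine sc_nf_arr fun u hu => ih fun c hc => ?_
    -- The test context for `q` is `λw. c (w u)`, which turns a test `c` of `q u` into a test of
    -- `q`.
    have key : ∀ w : Preterm F V [] (SimpleType.arr β₁ β₂),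
        nf (.app (.lam (.app c.wk (.app (.bvar .zero) u.wk))) w) = nf (.app c (.app w u)) :=
      fun w => nf_eq_of_eval_eq fun φ e => by simp only [eval, eval_wk, consEnv]
    rw [← key]
    exact h _ (sc_nf_arr fun w hw => by rw [key]; exact sc_nf_app hc (sc_nf_app hw hu))

/-- If `p` is `y` applied to `m` arguments, the witness is `λx₁ … xₘ. c`, which discards them all.
-/
theorem exists_sc_forall_nf_bind_eq {R : HRS F V} {γ δ : SimpleType B} {y : V γ}
    {p : Preterm F V [] δ} (hp : (Preterm.fvar y : Preterm F V [] γ).IsPrefix p)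
    {c : Preterm F V [] δ} (hc : R.SC δ (nf c)) :
    ∃ e : Preterm F V [] γ, R.SC γ (nf e) ∧ ∀ (θ : ∀ γ, V γ → Preterm F V [] γ)
      (σ : ∀ γ, BVar [] γ → Preterm F V [] γ), θ γ y = e → nf (p.bind θ σ) = nf c := by
  induction hp with
  | refl => exact ⟨c, hc, fun θ σ h => by rw [← h]; rfl⟩
  | @app β _ s t _ ih =>
    have key : ∀ w : Preterm F V [] β, nf (.app (.lam c.wk) w) = nf c :=
      fun w => nf_eq_of_eval_eq fun φ e => by simp only [eval, eval_wk]
    obtain ⟨e, he, h⟩ := ih (c := .lam c.wk) (sc_nf_arr fun w _ => by rwa [key])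
    refine ⟨e, he, fun θ σ hθ => ?_⟩
    rw [bind, ← nf_app_nf_left, h θ σ hθ, nf_app_nf_left, key]

/-- If `s` is `p t` applied to `k` further arguments, the witness is `λw v₁ … vₖ. c w`, which keeps
`t` and discards the others. -/
theorem exists_sc_nf_bind_eq_app {R : HRS F V} {β δ ε : SimpleType B}
    {p : Preterm F V [] (SimpleType.arr β δ)} {t : Preterm F V [] β} {s : Preterm F V [] ε}
    (hs : (Preterm.app p t).IsPrefix s) {c : Preterm F V [] (SimpleType.arr β ε)}
    (hc : R.SC _ (nf c)) :
    ∃ c' : Preterm F V [] (SimpleType.arr β δ), R.SC _ (nf c') ∧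
      ∀ (θ : ∀ γ, V γ → Preterm F V [] γ) (σ : ∀ γ, BVar [] γ → Preterm F V [] γ),
        nf (p.bind θ σ) = nf c' → nf (s.bind θ σ) = nf (.app c (t.bind θ σ)) := by
  induction hs with
  | refl =>
    refine ⟨c, hc, fun θ σ h => ?_⟩
    rw [bind, ← nf_app_nf_left, h, nf_app_nf_left]
  | @app β' ε s u _ ih =>
    have key : ∀ w v, nf (.app (.app
        (.lam (.lam (.app c.wk.wk (.bvar (.succ .zero)))) : Preterm F V [] (.arr β (.arr β' ε)))
          w) v) = nf (.app c w) :=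
      fun w v => nf_eq_of_eval_eq fun φ e => by simp only [eval, eval_wk, consEnv]
    obtain ⟨c', hc', h⟩ := ih
      (c := .lam (.lam (.app c.wk.wk (.bvar (.succ .zero)))))
      (sc_nf_arr fun w hw => sc_nf_arr fun v _ => by rw [key]; exact sc_nf_app hc hw)
    refine ⟨c', hc', fun θ σ hθ => ?_⟩
    rw [bind, ← nf_app_nf_left, h θ σ hθ, nf_app_nf_left, key]

theorem exists_update {Γ : List (SimpleType B)} {α : SimpleType B}
    (θ : ∀ γ, V γ → Preterm F V Γ γ) (y : V α) (u : Preterm F V Γ α) :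
    ∃ θ' : ∀ γ, V γ → Preterm F V Γ γ, θ' α y = u ∧
      ∀ γ z, (⟨γ, z⟩ : Σ γ, V γ) ≠ ⟨α, y⟩ → θ' γ z = θ γ z := by
  classical
  refine ⟨fun γ z => Function.update (β := fun x : Σ γ, V γ => Preterm F V Γ x.1)
    (fun x => θ x.1 x.2) ⟨α, y⟩ u ⟨γ, z⟩, ?_, fun γ z h => ?_⟩
  · exact Function.update_self (β := fun x : Σ γ, V γ => Preterm F V Γ x.1) _ _ _
  · exact Function.update_of_ne (β := fun x : Σ γ, V γ => Preterm F V Γ x.1) h _ _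

theorem under_wk {Γ : List (SimpleType B)} {α β : SimpleType B} (t : Preterm F V [] α) :
    (t.under Γ).wk (β := β) = t.under (β :: Γ) := by
  rw [under, under, wk, ren_ren]
  congr 1
  funext γ i
  exact nomatch i

/-- Instantiation can create a head redex only at a free variable. No head passed on the way to a
stable subterm is one, so the path to it survives normalization, provided the bound variables are
left in place. -/
theorem SSub.sub_nf_bind {Γ Δ : List (SimpleType B)} {α β : SimpleType B}
    {s : Preterm F V Γ α} {u : Preterm F V Δ β} (h : s.SSub u) (hs : s.IsTerm)
    (θ : ∀ γ, V γ → Preterm F V [] γ) :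
    (nf (s.bind (fun γ y => (θ γ y).under Γ) fun _ i => .bvar i)).Sub
      (nf (u.bind (fun γ y => (θ γ y).under Δ) fun _ i => .bvar i)) := by
  induction h with
  | refl t => exact .refl _
  | lam _ ih =>
    cases hs with
    | lam hs =>
      simp only [bind, nf_lam, under_wk, liftSub_bvar_id]
      exact .lam (ih hs)
  | arg hv ha _ ih =>
    refine .arg ?_ (ih (hs.isTerm_of_isArg ha))
    cases hs with
    | lam _ =>
      obtain ⟨γ, p, hp⟩ := ha
      cases hp
    | base hs =>
      obtain ⟨δ, a, hA, hp⟩ := hs.exists_head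
      have hA' : (a.bind (fun γ y => (θ γ y).under _) fun _ i => .bvar i).IsAtom := by
        rcases hA with (⟨y, rfl⟩ | ⟨i, rfl⟩) | ⟨f, rfl⟩
        · exact absurd hp (hv _ y)
        · exact .inl (.inr ⟨i, rfl⟩)
        · exact isAtom_sym f
      rw [nf_eq_argNf hA' (hp.bind _ _)]
      exact (ha.bind _ _).argNf

theorem StepAcc.of_under {R : HRS F V} {Δ : List (SimpleType B)} {α : SimpleType B}
    {t : Preterm F V [] α} (h : StepAcc R (t.under Δ)) : StepAcc R t :=
  StepAcc.of_map (f := fun t => t.under Δ) h fun _ _ h => h.ren _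

/-- Instantiation and normalization commute with a vacuous abstraction, and a step of the body is a
step of the abstraction. -/
theorem stepAcc_nf_of_isVacuousAbs {R : HRS F V} {α β : SimpleType B} {t : Preterm F V [] β}
    {s : Preterm F V [] α} (h : t.IsVacuousAbs s) (θ : ∀ γ, V γ → Preterm F V [] γ)
    (σ : ∀ γ, BVar [] γ → Preterm F V [] γ) (hs : StepAcc R (nf (s.bind θ σ))) :
    StepAcc R (nf (t.bind θ σ)) := by
  induction h with
  | refl => exact hs
  | @lam α γ s _ ih =>
    have e : nf ((Preterm.lam (s.wk : Preterm F V [γ] α)).bind θ σ) =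
        .lam (nf (s.bind θ σ)).wk := by
      rw [wk, wk, ← nf_ren, ← nf_lam]
      exact nf_eq_of_eval_eq fun φ e => by
        simp only [bind, eval, eval_ren, eval_bind, wk, liftSub, consEnv]
        rfl
    rw [e] at hs
    exact ih (StepAcc.of_map (f := fun s => .lam s.wk) hs fun _ _ h => .lam (h.ren _))

/-- Induction on accessibility with `θ` varying: variables not free in `l'` may take arbitrary
computable values without affecting the instance of `l'`. This freedom is what the clauses that
remove or project a fresh variable exploit. -/
theorem Accessible.sc [∀ α, Infinite (V α)] {R : HRS F V} {α δ : SimpleType B}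
    {l' : Preterm F V [] δ} {t : Preterm F V [] α} (h : l'.Accessible t) (hl' : l'.IsTerm)
    (θ : ∀ γ, V γ → Preterm F V [] γ) (σ : ∀ γ, BVar [] γ → Preterm F V [] γ)
    (hθ : ∀ γ y, (⟨γ, y⟩ : Σ γ, V γ) ∉ l'.fv → R.SC γ (nf (θ γ y)))
    (hSC : R.SC δ (nf (l'.bind θ σ))) : R.SC α (nf (t.bind θ σ)) := by
  induction h generalizing θ with
  | self => exact hSC
  | @sub b t Δ hsub _ =>
    have h := hsub.sub_nf_bind hl' θ
    have e₁ : nf (l'.bind (fun γ y => (θ γ y).under []) fun _ i => .bvar i) =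
        nf (l'.bind θ σ) := by
      congr 1
      refine bind_congr_fv _ (fun γ y _ => ?_) fun γ i => nomatch i
      rw [under]
      convert ren_id _ using 2
      funext γ i
      exact nomatch i
    have e₂ : nf ((t.under Δ).bind (fun γ y => (θ γ y).under Δ) fun _ i => .bvar i) =
        (nf (t.bind θ σ)).under Δ := by
      rw [under, ren_bind, under, ← nf_ren, bind_ren]
      congr 1
      exact bind_congr_fv _ (fun γ y _ => rfl) fun γ i => nomatch i
    rw [e₁, e₂] at h
    exact sn_iff_stepAcc.2 ((stepAcc_of_sc (isTerm_nf _) hSC).sub h).of_under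
  | @abs α β s y _ _ hy ih =>
    have e : nf ((s.inst (.fvar y)).bind θ σ) = nf (.app ((Preterm.lam s).bind θ σ) (θ α y)) :=
      nf_eq_of_eval_eq fun φ e => by
        rw [eval_bind, eval_inst]
        simp only [eval, eval_bind]
    rw [e]
    exact sc_nf_app (ih θ hθ hSC) (hθ _ y hy)
  -- The fresh `y` is sent to the arbitrary computable argument `u`, which turns the hypothesis on
  -- `t y` into one on `t u`.
  | @eta α β t y _ hy ih =>
    refine sc_nf_arr fun u hu => ?_
    obtain ⟨θ', hy', hne⟩ := exists_update θ y u
    have hfv : ∀ {ε : SimpleType B} (s : Preterm F V [] ε),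
        (⟨α, y⟩ : Σ γ, V γ) ∉ s.fv → s.bind θ' σ = s.bind θ σ := fun s hs =>
      bind_congr_fv s (fun γ z hz => hne γ z fun e => hs (e ▸ hz)) fun _ _ => rfl
    have h := ih θ' (fun γ z hz => by
        by_cases e : (⟨γ, z⟩ : Σ γ, V γ) = ⟨α, y⟩
        · cases e; rwa [hy']
        · rw [hne γ z e]; exact hθ γ z hz)
      (by rwa [hfv l' fun h => hy (.inr h)])
    rw [bind, hfv t fun h => hy (.inl h), ← nf_app_nf, nf_bind_nf] at h
    rwa [nf_app_nf, bind, hy'] at h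
  | @func α γ ε b f s ti t _ hf hti hvac ih =>
    have h := ih θ hθ hSC
    exact sn_iff_stepAcc.2 (stepAcc_nf_of_isVacuousAbs hvac θ σ
      (stepAcc_nf_of_isArg (isAtom_sym f) (hf.bind θ σ) h (hti.bind θ σ)))
  -- The fresh head `y` is sent to a function that selects `t` and applies the test context `c` to
  -- it; `t` does not contain `y`, so its own instance is unchanged.
  | @proj α β γ y s t _ hy hts hfv hyl ih =>
    refine sc_nf_of_forall_app (ε := α) fun c hc => ?_
    obtain ⟨δ', p, hp⟩ := hts
    obtain ⟨c', hc', h₁⟩ := exists_sc_nf_bind_eq_app hp hc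
    obtain ⟨e, he, h₂⟩ := exists_sc_forall_nf_bind_eq
      ((isAtom_fvar y).isPrefix_of_isPrefix hy hp) hc'
    obtain ⟨θ', hy', hne⟩ := exists_update θ y e
    have hb : ∀ {ε : SimpleType B} (s : Preterm F V [] ε),
        (⟨γ, y⟩ : Σ γ, V γ) ∉ s.fv → s.bind θ' σ = s.bind θ σ := fun s hs =>
      bind_congr_fv s (fun γ z hz => hne γ z fun e => hs (e ▸ hz)) fun _ _ => rfl
    have h := ih θ' (fun γ' z hz => by
        by_cases e : (⟨γ', z⟩ : Σ γ, V γ) = ⟨γ, y⟩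
        · cases e; rwa [hy']
        · rw [hne γ' z e]; exact hθ γ' z hz)
      (by rwa [hb l' hyl])
    rwa [h₁ θ' σ (h₂ θ' σ hy'), hb t (hfv _ t ⟨δ', p, hp⟩)] at h

theorem Safe.sc [∀ α, Infinite (V α)] {R : HRS F V} {α β : SimpleType B}
    {l : Preterm F V [] α} {u : Preterm F V [] β} (h : l.Safe u) (hl : l.IsTerm)
    (θ : ∀ γ, V γ → Preterm F V [] γ) (σ : ∀ γ, BVar [] γ → Preterm F V [] γ)
    (hSC : ∀ (δ : SimpleType B) (l' : Preterm F V [] δ), l'.IsArg l →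
      R.SC δ (nf (l'.bind θ σ))) : R.SC β (nf (u.bind θ σ)) := by
  classical
  obtain ⟨δ, l', t, hl', hacc, hfv, rfl⟩ := h
  -- Outside `l'` the variables are reset to themselves, which makes them computable. The instances
  -- of `t` and `l'` do not see the change.
  let θ' : ∀ γ, V γ → Preterm F V [] γ := fun γ y =>
    if (⟨γ, y⟩ : Σ γ, V γ) ∈ l'.fv then θ γ y else .fvar y
  have hb : ∀ {ε : SimpleType B} (s : Preterm F V [] ε), s.fv ⊆ l'.fv →
      s.bind θ' σ = s.bind θ σ := fun s hs =>
    bind_congr_fv s (fun γ y hy => if_pos (hs hy)) fun _ _ => rfl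
  rw [nf_bind_nf, ← hb t hfv]
  refine hacc.sc (hl.isTerm_of_isArg hl') θ' σ (fun γ y hy => ?_) ?_
  · simp only [θ', if_neg hy]
    exact sc_nf_fvar R y
  · rw [hb l' subset_rfl]
    exact hSC δ l' hl'

/-! ### Change of signature -/

section Map

variable {G : SimpleType B → Type x} (g : ∀ α, F α → G α)

theorem map_ren {Γ Δ : List (SimpleType B)} {α : SimpleType B} (t : Preterm F V Γ α)
    (ρ : ∀ γ, BVar Γ γ → BVar Δ γ) : (t.ren ρ).map g = (t.map g).ren ρ := by
  induction t generalizing Δ with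
  | fvar y => rfl
  | bvar i => rfl
  | sym f => rfl
  | lam s ih => simp only [ren, map, ih]
  | app s t ihs iht => simp only [ren, map, ihs, iht]

theorem map_bind {Γ Δ : List (SimpleType B)} {α : SimpleType B} (t : Preterm F V Γ α)
    (θ : ∀ γ, V γ → Preterm F V Δ γ) (σ : ∀ γ, BVar Γ γ → Preterm F V Δ γ) :
    (t.bind θ σ).map g =
      (t.map g).bind (fun γ y => (θ γ y).map g) (fun γ i => (σ γ i).map g) := by
  induction t generalizing Δ with
  | fvar y => rfl
  | bvar i => rfl
  | sym f => rfl
  | lam s ih =>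
    simp only [bind, map, ih, wk, map_ren]
    congr 2
    funext γ i
    cases i
    · rfl
    · exact map_ren g _ _
  | app s t ihs iht => simp only [bind, map, ihs, iht]

theorem Conv.map {Γ : List (SimpleType B)} {α : SimpleType B} {s t : Preterm F V Γ α}
    (h : Conv s t) : Conv (s.map g) (t.map g) := by
  induction h with
  | beta s u =>
    have e : (s.inst u).map g = (s.map g).inst (u.map g) := by
      rw [inst, map_bind, inst]
      congr 1
      funext γ i
      cases i <;> rfl
    rw [e]
    exact .beta _ _
  | eta t =>
    simp only [Preterm.map, wk, map_ren]
    exact .eta _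
  | lam _ ih => exact .lam ih
  | app _ _ ih₁ ih₂ => exact .app ih₁ ih₂
  | refl t => exact .refl _
  | symm _ ih => exact .symm ih
  | trans _ _ ih₁ ih₂ => exact .trans ih₁ ih₂

theorem isNeutral_isTerm_map :
    (∀ {Γ : List (SimpleType B)} {α : SimpleType B} {t : Preterm F V Γ α}, t.IsNeutral →
      (t.map g).IsNeutral) ∧
    (∀ {Γ : List (SimpleType B)} {α : SimpleType B} {t : Preterm F V Γ α}, t.IsTerm →
      (t.map g).IsTerm) := by
  apply neutral_term_induction (N := fun t => (t.map g).IsNeutral)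
    (T := fun t => (t.map g).IsTerm)
  · intro Γ α y; exact .fvar y
  · intro Γ α i; exact .bvar i
  · intro Γ α f; exact .sym _
  · intro Γ α β s t _ _ ih₁ ih₂; exact .app ih₁ ih₂
  · intro Γ α β s _ ih; exact .lam ih
  · intro Γ b t _ ih; exact .base ih

theorem map_nf {Γ : List (SimpleType B)} {α : SimpleType B} (t : Preterm F V Γ α) :
    (nf t).map g = nf (t.map g) :=
  (((isNeutral_isTerm_map g).2 (isTerm_nf t)).nf_eq_of_conv ((conv_nf t).map g)).symm

end Map

end Preterm

namespace HRS

open Preterm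

variable {B : Type u} {F : SimpleType B → Type v} {V : SimpleType B → Type w}

-- Marked terms: instances and rewriting

theorem embed_nf (R : HRS F V) {Γ : List (SimpleType B)} {α : SimpleType B}
    (t : Preterm F V Γ α) : R.embed (nf t) = nf (R.embed t) :=
  map_nf _ t

/-- A substitution seen in the signature with marked symbols. -/
def embedSubst (R : HRS F V) {Γ : List (SimpleType B)} (θ : TermSubst F V Γ) :
    TermSubst R.MarkedSym V Γ where
  toFun γ y := R.embed (θ.toFun γ y)
  isTerm γ y := (isNeutral_isTerm_map _).2 (θ.isTerm γ y)
  finite_dom := θ.finite_dom.subset fun y hy h => hy <| by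
    rw [← h, embed_nf]
    rfl

theorem embed_bind (R : HRS F V) {Γ Δ : List (SimpleType B)} {α : SimpleType B}
    (t : Preterm F V Γ α) (θ : ∀ γ, V γ → Preterm F V Δ γ)
    (σ : ∀ γ, BVar Γ γ → Preterm F V Δ γ) : R.embed (t.bind θ σ) =
      (R.embed t).bind (fun γ y => R.embed (θ γ y)) (fun γ i => R.embed (σ γ i)) :=
  map_bind _ t θ σ

theorem embed_instNf (R : HRS F V) {Γ : List (SimpleType B)} {α : SimpleType B}
    (t : Preterm F V [] α) (θ : TermSubst F V Γ) :
    R.embed (t.instNf θ) = (R.embed t).instNf (R.embedSubst θ) := by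
  rw [instNf, embed_nf, embed_bind]
  exact (instNf_eq _ (R.embedSubst θ) _).symm

theorem step_embed (R : HRS F V) {Γ : List (SimpleType B)} {α : SimpleType B}
    {s t : Preterm F V Γ α} (h : Step R.rule s t) :
    Step R.embedRule (R.embed s) (R.embed t) := by
  induction h with
  | root h θ =>
    rw [embed_instNf, embed_instNf]
    exact .root ⟨_, _, h, rfl, rfl⟩ _
  | lam _ ih => exact .lam ih
  | appFun _ ih => exact .appFun ih
  | appArg _ ih => exact .appArg ih

/-- Marking alters only the head, which a step inside an argument leaves alone. Root steps are
excluded because left-hand sides of rules have unmarked heads. -/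
theorem step_mark (R : HRS F V) {Γ : List (SimpleType B)} {α : SimpleType B}
    {s t : Preterm F V Γ α} (h : ArgStep R s t) : Step R.embedRule (R.mark s) (R.mark t) := by
  induction h with
  | right h =>
    simp only [mark]
    exact .appArg (R.step_embed h)
  | left _ ih =>
    simp only [mark]
    exact .appFun ih

theorem exists_mark_sym (R : HRS F V) {δ : SimpleType B} (f : F δ) :
    ∃ g : R.MarkedSym δ, ∀ Γ : List (SimpleType B),
      R.mark (Preterm.sym f : Preterm F V Γ δ) = .sym g := by
  by_cases h : R.Defined f
  · exact ⟨Sum.inr ⟨f, h⟩, fun Γ => by rw [mark, dif_pos h]⟩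
  · exact ⟨Sum.inl f, fun Γ => by rw [mark, dif_neg h]⟩

/-- With a function symbol at the head, instantiation and normalization act on the arguments only,
so they commute with changing the head. -/
theorem markInst_eq_mark (R : HRS F V) {b : B} {δ : SimpleType B} {f : F δ}
    {t : Preterm F V [] (SimpleType.base b)}
    (h : (Preterm.sym f : Preterm F V [] δ).IsPrefix t) (θ : TermSubst F V []) :
    R.markInst t θ = R.mark (t.instNf θ) := by
  let σ : ∀ γ, BVar [] γ → Preterm F V [] γ := fun _ i => nomatch i
  let σ' : ∀ γ, BVar [] γ → Preterm R.MarkedSym V [] γ := fun _ i => nomatch i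
  obtain ⟨g, hg⟩ := R.exists_mark_sym (V := V) f
  have key : ∀ {α : SimpleType B} {t : Preterm F V [] α},
      (Preterm.sym f : Preterm F V [] δ).IsPrefix t →
      (Preterm.sym g : Preterm R.MarkedSym V [] δ).IsPrefix
        ((R.mark t).bind (fun γ y => R.embed (θ.toFun γ y)) σ') ∧
      ((R.mark t).bind (fun γ y => R.embed (θ.toFun γ y)) σ').argNf =
        R.mark (t.bind θ.toFun σ).argNf := by
    intro α t h
    induction h with
    | refl =>
      rw [hg]
      exact ⟨.refl, (hg []).symm⟩
    | @app _ _ s t _ ih =>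
      refine ⟨?_, ?_⟩
      · simp only [mark]
        exact .app ih.1
      · simp only [mark, Preterm.bind, Preterm.argNf, ih.2]
        congr 1
        rw [embed_nf, embed_bind]
        refine congrArg nf ?_
        exact bind_congr_fv _ (fun _ _ _ => rfl) fun _ i => nomatch i
  have h' : (Preterm.sym f : Preterm F V [] δ).IsPrefix (t.bind θ.toFun σ) := h.bind _ _
  have e : R.markInst t θ = nf ((R.mark t).bind (fun γ y => R.embed (θ.toFun γ y)) σ') :=
    congrArg nf (bind_congr_fv _ (fun _ _ _ => rfl) fun _ i => nomatch i)
  rw [e, instNf_eq t θ σ, nf_eq_argNf (isAtom_sym g) (key h).1, (key h).2,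
    nf_eq_argNf (isAtom_sym f) h']

end HRS

namespace Preterm

variable {B : Type u} {F : SimpleType B → Type v} {V : SimpleType B → Type w}

/-! ### Fresh names -/

theorem exists_fresh_names [∀ α, Infinite (V α)] (Δ : List (SimpleType B))
    {A : Set (Σ γ, V γ)} (hA : A.Finite) :
    ∃ ρ : ∀ ε, BVar Δ ε → V ε, (∀ γ, Function.Injective (ρ γ)) ∧
      ∀ (γ : SimpleType B) (i : BVar Δ γ), (⟨γ, ρ γ i⟩ : Σ γ, V γ) ∉ A := by
  induction Δ generalizing A with
  | nil => exact ⟨fun _ i => (nomatch i), fun γ i => (nomatch i), fun γ i => (nomatch i)⟩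
  | cons α Δ ih =>
    obtain ⟨y, hy⟩ : ∃ y : V α, (⟨α, y⟩ : Σ γ, V γ) ∉ A :=
      ((hA.preimage (f := fun y : V α => (⟨α, y⟩ : Σ γ, V γ))
        (sigma_mk_injective.injOn)).infinite_compl).nonempty
    obtain ⟨ρ, hinj, hρ⟩ := ih (hA.insert ⟨α, y⟩)
    refine ⟨fun _ i => match i with
      | .zero => y
      | .succ i => ρ _ i, fun γ i j h => ?_, fun γ i => ?_⟩
    · cases i <;> cases j
      · rfl
      · rename_i j
        exact absurd (Or.inl (congrArg (Sigma.mk α) h.symm)) (hρ _ j)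
      · rename_i i
        exact absurd (Or.inl (congrArg (Sigma.mk _) h)) (hρ _ i)
      · exact congrArg _ (hinj _ h)
    · cases i
      · exact hy
      · rename_i i
        exact fun h => hρ _ i (Or.inr h)

/-- The binders above a subterm of `r` receive names not free in `l`, so a single substitution can
act as `θ` on `l` and give the binders their values. Injectivity of the naming makes it well
defined. -/
theorem exists_extension {Δ : List (SimpleType B)} {α : SimpleType B} {l : Preterm F V [] α}
    {ρ : ∀ ε, BVar Δ ε → V ε} (hρ : HRS.FreshNames l ρ) (θ : ∀ γ, V γ → Preterm F V [] γ)
    (σ : ∀ γ, BVar Δ γ → Preterm F V [] γ) :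
    ∃ θ' : ∀ γ, V γ → Preterm F V [] γ,
      (∀ γ y, (⟨γ, y⟩ : Σ γ, V γ) ∈ l.fv → θ' γ y = θ γ y) ∧ ∀ γ i, θ' γ (ρ γ i) = σ γ i := by
  classical
  refine ⟨fun γ y => if h : ∃ i, ρ γ i = y then σ γ h.choose else θ γ y, fun γ y hy => ?_,
    fun γ i => ?_⟩
  · refine dif_neg ?_
    rintro ⟨i, rfl⟩
    exact hρ.2 γ i hy
  · have h : ∃ j, ρ γ j = ρ γ i := ⟨i, rfl⟩
    exact (dif_pos h).trans (congrArg _ (hρ.1 γ h.choose_spec))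

theorem named_bind {Δ : List (SimpleType B)} {α β : SimpleType B} {l : Preterm F V [] β}
    {t : Preterm F V Δ α} (ht : t.fv ⊆ l.fv) {ρ : ∀ ε, BVar Δ ε → V ε}
    {θ θ' : ∀ γ, V γ → Preterm F V [] γ} {σ : ∀ γ, BVar Δ γ → Preterm F V [] γ}
    (hθ : ∀ γ y, (⟨γ, y⟩ : Σ γ, V γ) ∈ l.fv → θ' γ y = θ γ y)
    (hσ : ∀ γ i, θ' γ (ρ γ i) = σ γ i) (σ' : ∀ γ, BVar [] γ → Preterm F V [] γ) :
    (t.named ρ).bind θ' σ' = t.bind θ σ := by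
  rw [named, bind_bind]
  exact bind_congr_fv t (fun γ y hy => hθ γ y (ht hy)) hσ

theorem IsPrefix.fv_subset {Γ : List (SimpleType B)} {α β : SimpleType B}
    {p : Preterm F V Γ α} {t : Preterm F V Γ β} (h : p.IsPrefix t) : p.fv ⊆ t.fv := by
  induction h with
  | refl => exact subset_rfl
  | app _ ih => exact ih.trans Set.subset_union_left

theorem IsArg.fv_subset {Γ : List (SimpleType B)} {α β : SimpleType B}
    {u : Preterm F V Γ α} {t : Preterm F V Γ β} (h : u.IsArg t) : u.fv ⊆ t.fv :=
  let ⟨_, _, hp⟩ := h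
  Set.subset_union_right.trans hp.fv_subset

theorem Cand.fv_subset {Γ Δ : List (SimpleType B)} {α β : SimpleType B}
    {t : Preterm F V Γ α} {u : Preterm F V Δ β} (h : t.Cand u) : u.fv ⊆ t.fv := by
  induction h with
  | self t => exact subset_rfl
  | lam _ ih => exact ih
  | arg ha _ ih => exact ih.trans ha.fv_subset

theorem Cand.sub {Γ Δ : List (SimpleType B)} {α β : SimpleType B}
    {t : Preterm F V Γ α} {u : Preterm F V Δ β} (h : t.Cand u) : t.Sub u := by
  induction h with
  | self t => exact .refl t
  | lam _ ih => exact .lam ih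
  | arg ha _ ih => exact .arg ha ih

theorem Cand.trans {Γ Δ E : List (SimpleType B)} {α β γ : SimpleType B}
    {s : Preterm F V Γ α} {t : Preterm F V Δ β} {u : Preterm F V E γ} (h : s.Cand t)
    (h' : t.Cand u) : s.Cand u := by
  induction h with
  | self t => exact h'
  | lam _ ih => exact .lam (ih h')
  | arg ha _ ih => exact .arg ha (ih h')

/-! ### Strong computability of instances -/

/-- Instances of the terms satisfying `P` are strongly computable if this holds, under the
assumption that the instances of the arguments are, for those of basic type whose head is a free
variable or a defined symbol. -/
theorem sc_nf_bind [∀ α, Infinite (V α)] {R : HRS F V}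
    {P : ∀ {Δ : List (SimpleType B)} {α : SimpleType B}, Preterm F V Δ α → Prop}
    (hlam : ∀ {Δ : List (SimpleType B)} {α β : SimpleType B} {s : Preterm F V (α :: Δ) β},
      P (.lam s) → P s)
    (harg : ∀ {Δ : List (SimpleType B)} {α β : SimpleType B} {t : Preterm F V Δ α}
      {u : Preterm F V Δ β}, P t → u.IsArg t → P u)
    {θ : ∀ γ, V γ → Preterm F V [] γ}
    (hhead : ∀ {Δ : List (SimpleType B)} {b : B} {δ : SimpleType B}
      {t : Preterm F V Δ (SimpleType.base b)} {a : Preterm F V Δ δ}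
      {σ : ∀ γ, BVar Δ γ → Preterm F V [] γ}, P t → a.IsPrefix t →
      ((∃ Z, a = .fvar Z) ∨ ∃ f, a = .sym f ∧ R.Defined f) →
      (∀ γ i, R.SC γ (nf (σ γ i))) →
      (∀ (γ : SimpleType B) (u : Preterm F V Δ γ), u.IsArg t → R.SC γ (nf (u.bind θ σ))) →
      R.SC _ (nf (t.bind θ σ)))
    {Δ : List (SimpleType B)} {α : SimpleType B} {t : Preterm F V Δ α} (ht : t.IsTerm) (hP : P t)
    {σ : ∀ γ, BVar Δ γ → Preterm F V [] γ} (hσ : ∀ γ i, R.SC γ (nf (σ γ i))) :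
    R.SC α (nf (t.bind θ σ)) := by
  -- For neutral preterms only the arguments are claimed to be computable. The head is examined once
  -- basic type is reached and all arguments are available.
  refine (neutral_term_induction (F := F) (V := V)
    (N := fun {Δ α} n => (∀ (β : SimpleType B) (u : Preterm F V Δ β), u.IsArg n → P u) →
      ∀ {σ : ∀ γ, BVar Δ γ → Preterm F V [] γ}, (∀ γ i, R.SC γ (nf (σ γ i))) →
        ∀ (β : SimpleType B) (u : Preterm F V Δ β), u.IsArg n → R.SC β (nf (u.bind θ σ)))
    (T := fun {Δ α} t => P t → ∀ {σ : ∀ γ, BVar Δ γ → Preterm F V [] γ},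
      (∀ γ i, R.SC γ (nf (σ γ i))) → R.SC α (nf (t.bind θ σ))) ?_ ?_ ?_ ?_ ?_ ?_).2 ht hP hσ
  · exact fun y _ _ _ _ _ hu => absurd hu (isAtom_fvar y).not_isArg
  · exact fun i _ _ _ _ _ hu => absurd hu (IsAtom.not_isArg (.inl (.inr ⟨i, rfl⟩)))
  · exact fun f _ _ _ _ _ hu => absurd hu (isAtom_sym f).not_isArg
  · intro Δ α β s t _ _ ihs iht hP σ hσ γ u hu
    rcases hu.eq_or_of_app with hu | hu
    · cases hu
      exact iht (hP _ _ (isArg_app_right _ _)) hσ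
    · exact ihs (fun δ v hv => hP δ v (hv.app_left _)) hσ γ u hu
  · intro Δ α β s _ ih hP σ hσ
    refine sc_nf_arr fun u hu => ?_
    have e : nf (.app ((Preterm.lam s).bind θ σ) u) = nf (s.bind θ (consSub u σ)) := by
      rw [← bind_liftSub_inst]
      exact nf_eq_of_conv (.beta _ _)
    rw [e]
    refine ih (hlam hP) fun γ i => ?_
    cases i
    · exact hu
    · exact hσ _ _
  · intro Δ b t hn ih hP σ hσ
    have hargs := ih (fun β u hu => harg hP hu) hσ
    obtain ⟨δ, a, ha, hp⟩ := hn.exists_head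
    rcases ha with (⟨Z, rfl⟩ | ⟨i, rfl⟩) | ⟨f, rfl⟩
    · exact hhead hP hp (.inl ⟨Z, rfl⟩) hσ hargs
    · exact sc_nf_of_isPrefix hp (hσ _ i) hargs
    · by_cases hf : R.Defined f
      · exact hhead hP hp (.inr ⟨f, rfl, hf⟩) hσ hargs
      · refine sc_nf_of_isPrefix hp ((sc_inert_and_stepAcc R _).1 _ (.sym f) ?_ ?_) hargs
        · rintro _ g hg
          cases hg
          exact hf
        · exact fun _ u hu => absurd hu (isAtom_sym f).not_isArg

/-! ### Minimal non-terminating terms -/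

/-- The terms `f(t₁, …, tₙ)` of basic type with `f` defined that are not strongly normalizing
although all their arguments are strongly computable. -/
structure Minimal (R : HRS F V) {b : B} (t : Preterm F V [] (SimpleType.base b)) : Prop where
  isNeutral : t.IsNeutral
  exists_head : ∃ (α : SimpleType B) (f : F α),
    (Preterm.sym f : Preterm F V [] α).IsPrefix t ∧ R.Defined f
  scArgs : R.SCArgs t
  not_stepAcc : ¬ StepAcc R t

/-- The defined head survives instantiation, and the arguments of the normal form are the normalized
instances of the original ones; so failure of computability leaves a minimal term. -/
theorem sc_or_minimal {R : HRS F V} {Δ : List (SimpleType B)} {b : B} {δ : SimpleType B}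
    {f : F δ} {t : Preterm F V Δ (SimpleType.base b)}
    (hp : (Preterm.sym f : Preterm F V Δ δ).IsPrefix t) (hf : R.Defined f)
    {θ : ∀ γ, V γ → Preterm F V [] γ} {σ : ∀ γ, BVar Δ γ → Preterm F V [] γ}
    (h : ∀ (γ : SimpleType B) (u : Preterm F V Δ γ), u.IsArg t → R.SC γ (nf (u.bind θ σ))) :
    R.SC _ (nf (t.bind θ σ)) ∨ Minimal R (nf (t.bind θ σ)) := by
  by_cases hSN : R.SC _ (nf (t.bind θ σ))
  · exact .inl hSN
  · have hp' : (Preterm.sym f : Preterm F V [] δ).IsPrefix (t.bind θ σ) := hp.bind θ σ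
    have e := nf_eq_argNf (isAtom_sym f) hp'
    refine .inr ⟨isNeutral_of_isTerm (isTerm_nf _), ⟨δ, f, ?_, hf⟩, ?_,
      fun h => hSN (sn_iff_stepAcc.2 h)⟩
    · rw [e]
      exact hp'.argNf (isAtom_sym f)
    · intro γ v hv
      rw [e] at hv
      obtain ⟨w, hw, rfl⟩ := hv.exists_of_argNf (isAtom_sym f) hp'
      obtain ⟨u, hu, rfl⟩ := hw.exists_of_bind (h := .sym f) (θ := θ) (σ := σ) (isAtom_sym f) hp
      exact h γ u hu

/-- Without minimal terms the induction of `sc_nf_bind`, run with the identity substitution, would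
make every term computable and hence normalizing. -/
theorem exists_minimal [∀ α, Infinite (V α)] {R : HRS F V} (h : ¬ R.Terminating) :
    ∃ (b : B) (t : Preterm F V [] (SimpleType.base b)), Minimal R t := by
  by_contra hno
  refine h fun α t ht => sn_iff_stepAcc.2 (stepAcc_of_sc ht ?_)
  have h := sc_nf_bind (R := R) (P := fun _ => True) (fun _ => trivial) (fun _ _ => trivial)
    (θ := fun _ y => .fvar y) (by
      rintro Δ b δ t a σ - hp (⟨Z, rfl⟩ | ⟨f, rfl, hf⟩) hσ hargs
      · exact sc_nf_of_isPrefix hp (sc_nf_fvar R Z) hargs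
      · exact (sc_or_minimal hp hf hargs).resolve_right fun h => hno ⟨_, _, h⟩)
    ht trivial (σ := fun _ i => .bvar i) (fun _ i => nomatch i)
  rwa [bind_id, ht.nf_eq] at h

/-- Induction along argument steps, which terminate because the arguments are computable. A
non-terminating successor is either again minimal, after an argument step, or the contractum sought.
-/
theorem Minimal.exists_root [∀ α, Infinite (V α)] {R : HRS F V} {b : B}
    {t : Preterm F V [] (SimpleType.base b)} (h : Minimal R t) :
    ∃ (l r : Preterm F V [] (SimpleType.base b)) (θ : TermSubst F V []),
      R.rule l r ∧ ReflTransGen (ArgStep R) t (l.instNf θ) ∧ R.SCArgs (l.instNf θ) ∧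
      ¬ StepAcc R (r.instNf θ) := by
  have ha := acc_argStep t fun δ u hu =>
    stepAcc_of_sc (h.isNeutral.isTerm_of_isArg hu) (h.scArgs δ u hu)
  induction ha with
  | intro t _ ih =>
    obtain ⟨t', hs, ht'⟩ : ∃ t', Step R.rule t t' ∧ ¬ StepAcc R t' := by
      by_contra! hno
      exact h.not_stepAcc (.intro t hno)
    rcases hs.argStep_or_root h.isNeutral with ha | ⟨b', l, r, θ, hlr, e⟩
    · have hmin : Minimal R t' := by
        refine ⟨hs.isNeutral_isTerm.1 h.isNeutral, ?_, fun δ u hu => ?_, ht'⟩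
        · obtain ⟨α, f, hf, hd⟩ := h.exists_head
          exact ⟨α, f, (ha.isPrefix_iff (isAtom_sym f)).1 hf, hd⟩
        · obtain ⟨u', hu', hsteps⟩ := ha.exists_steps_of_isArg hu
          exact sc_steps hsteps (h.scArgs δ u' hu')
      obtain ⟨l, r, θ, hlr, hred, hrest⟩ := ih t' ha hmin
      exact ⟨l, r, θ, hlr, .head ha hred, hrest⟩
    · cases e
      exact ⟨l, r, θ, hlr, .refl, h.scArgs, ht'⟩

/-- If no pair had a minimal instance, all candidates of `r` would have computable instances, `r`
included. The assignment `σ` of computable values to the binders crossed so far is built into a new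
substitution `θ'`, since the pair mentions those binders as named variables. -/
theorem exists_isSDP_minimal [∀ α, Infinite (V α)] {R : HRS F V} (hR : R.PFP) {b : B}
    {l r : Preterm F V [] (SimpleType.base b)} (hlr : R.rule l r) (θ : TermSubst F V [])
    (hargs : R.SCArgs (l.instNf θ)) (hr : ¬ StepAcc R (r.instNf θ)) :
    ∃ (c : B) (v : Preterm F V [] (SimpleType.base c)) (θ' : TermSubst F V []),
      R.IsSDP l v ∧ l.instNf θ' = l.instNf θ ∧ Minimal R (v.instNf θ') := by
  by_contra hno
  obtain ⟨σ₀⟩ : Nonempty (∀ γ, BVar [] γ → Preterm F V [] γ) := ⟨fun _ i => nomatch i⟩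
  obtain ⟨α₀, f₀, hf₀⟩ := R.left_top hlr
  have hl : ∀ (δ : SimpleType B) (l' : Preterm F V [] δ), l'.IsArg l →
      R.SC δ (nf (l'.bind θ.toFun σ₀)) := by
    intro δ l' hl'
    have hp : (Preterm.sym f₀ : Preterm F V [] α₀).IsPrefix (l.bind θ.toFun σ₀) := hf₀.bind _ _
    refine hargs δ _ ?_
    rw [instNf_eq l θ σ₀, nf_eq_argNf (isAtom_sym f₀) hp]
    exact (hl'.bind θ.toFun σ₀).argNf
  have hsafe : ∀ {Δ : List (SimpleType B)} {β ε : SimpleType B} {t : Preterm F V Δ β}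
      {p : Preterm F V Δ ε} {ρ : ∀ ε, BVar Δ ε → V ε} {σ : ∀ γ, BVar Δ γ → Preterm F V [] γ},
      t.fv ⊆ l.fv → HRS.FreshNames l ρ → p.IsPrefix t → l.Safe (nf (p.named ρ)) →
      (∀ (γ : SimpleType B) (u : Preterm F V Δ γ), u.IsArg t →
        R.SC γ (nf (u.bind θ.toFun σ))) → R.SC β (nf (t.bind θ.toFun σ)) := by
    intro Δ β ε t p ρ σ hfv hρ hp hs h
    obtain ⟨θ', hθ', hσ'⟩ := exists_extension hρ θ.toFun σ
    refine sc_nf_of_isPrefix hp ?_ h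
    rw [← named_bind (hp.fv_subset.trans hfv) hθ' hσ' σ₀, ← nf_bind_nf]
    refine hs.sc (R.left_isTerm hlr) θ' σ₀ fun δ l' hl' => ?_
    rw [bind_congr_fv l' (fun γ y hy => hθ' γ y (hl'.fv_subset hy)) fun _ _ => rfl]
    exact hl δ l' hl'
  have hSC : R.SC _ (nf (r.bind θ.toFun σ₀)) := by
    refine sc_nf_bind (P := fun {Δ α} t => r.Cand t) (fun h => h.trans (.lam (.self _)))
      (fun h hu => h.trans (.arg hu (.self _))) ?_ (R.right_isTerm hlr) (.self r)
      fun _ i => nomatch i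
    intro Δ c δ t a σ hc hp ha hσ h
    have hfv : t.fv ⊆ l.fv := hc.fv_subset.trans (R.right_fv hlr)
    obtain ⟨ρ, hinj, hfresh⟩ := exists_fresh_names Δ l.fv_finite
    have hρ : HRS.FreshNames l ρ := ⟨hinj, hfresh⟩
    rcases ha with ⟨Z, rfl⟩ | ⟨f, rfl, hf⟩
    · obtain ⟨ε, p, hpt, hs⟩ := hR b l r hlr Δ _ _ t Z hc.sub hp ρ hρ
      exact hsafe hfv hρ hpt hs h
    · by_cases hex : ∃ (ε : SimpleType B) (p : Preterm F V Δ ε),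
          p.IsPrefix t ∧ l.Safe (nf (p.named ρ))
      · obtain ⟨ε, p, hpt, hs⟩ := hex
        exact hsafe hfv hρ hpt hs h
      · refine (sc_or_minimal hp hf h).resolve_right fun hmin => hno ?_
        -- This substitution leaves the instance of `l` as it is and makes that of the named
        -- candidate equal to the failing instance; it is then cut down to the free variables of the
        -- pair to have finite domain.
        obtain ⟨θ', hθ', hσ'⟩ := exists_extension hρ θ.toFun σ
        have hA : (l.fv ∪ (t.named ρ).fv).Finite := l.fv_finite.union (t.named ρ).fv_finite
        refine ⟨c, t.named ρ, TermSubst.restrict _ hA θ',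
          ⟨r, Δ, t, ρ, δ, f, hlr, hc, hρ, rfl, hf, hp, fun ε p hpt hs => hex ⟨ε, p, hpt, hs⟩⟩,
          ?_, ?_⟩
        · rw [instNf_restrict l hA θ' Set.subset_union_left σ₀, instNf_eq l θ σ₀,
            bind_congr_fv l hθ' fun _ _ => rfl]
        · rw [instNf_restrict _ hA θ' Set.subset_union_right σ₀, named_bind hfv hθ' hσ' σ₀]
          exact hmin
  rw [← instNf_eq r θ σ₀] at hSC
  exact hr (sn_iff_stepAcc.1 hSC)

theorem Minimal.exists_next [∀ α, Infinite (V α)] {R : HRS F V} (hR : R.PFP) {b : B}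
    {t : Preterm F V [] (SimpleType.base b)} (h : Minimal R t) :
    ∃ (l : Preterm F V [] (SimpleType.base b)) (θ : TermSubst F V []) (c : B)
      (v : Preterm F V [] (SimpleType.base c)), R.IsSDP l v ∧
      ReflTransGen (Step R.embedRule) (R.mark t) (R.markInst l θ) ∧ R.SCArgs (l.instNf θ) ∧
      Minimal R (v.instNf θ) := by
  obtain ⟨l, r, θ, hlr, hred, hargs, hr⟩ := h.exists_root
  obtain ⟨c, v, θ', hdp, e, hmin⟩ := exists_isSDP_minimal hR hlr θ hargs hr
  obtain ⟨α, f, hf⟩ := R.left_top hlr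
  refine ⟨l, θ', c, v, hdp, ?_, e ▸ hargs, hmin⟩
  rw [R.markInst_eq_mark hf, e]
  exact hred.lift (fun s => R.mark s) fun _ _ h => R.step_mark h

theorem nonempty_infiniteChain [∀ α, Infinite (V α)] {R : HRS F V} (hR : R.PFP)
    (h : ¬ R.Terminating) : Nonempty R.InfiniteChain := by
  obtain ⟨b, t, ht⟩ := exists_minimal h
  choose l θ c v hdp hred hu hmin using
    fun s : Σ b, {t : Preterm F V [] (SimpleType.base b) // Minimal R t} =>
      s.2.2.exists_next hR
  -- The state is a minimal term; its successor is the minimal instance of the right-hand side of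
  -- the chosen pair.
  let state : ℕ → Σ b, {t : Preterm F V [] (SimpleType.base b) // Minimal R t} :=
    Nat.rec ⟨b, t, ht⟩ fun _ s => ⟨c s, (v s).instNf (θ s), hmin s⟩
  refine ⟨{
    ty := fun i => (state i).1
    u := fun i => l (state i)
    v := fun i => v (state i)
    θ := fun i => θ (state i)
    isSDP := fun i => hdp (state i)
    red := fun i => ?_
    scArgs_u := fun i => hu (state i)
    scArgs_v := fun i => (hmin (state i)).scArgs }⟩
  obtain ⟨r, Δ, t, ρ, α, a, -, -, -, e, -, hp, -⟩ := hdp (state i)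
  have hv : (Preterm.sym a : Preterm F V [] α).IsPrefix (v (state i)) := by
    rw [e]
    exact hp.bind _ _
  rw [R.markInst_eq_mark hv]
  exact hred (state (i + 1))

end Preterm

theorem mainTheorem4 {B : Type u} {F : SimpleType B → Type v} {V : SimpleType B → Type w}
    [∀ α, Infinite (V α)] (R : HRS F V) (hR : R.PFP) (hchain : ¬ Nonempty R.InfiniteChain) :
    R.Terminating :=
  of_not_not fun h => hchain (Preterm.nonempty_infiniteChain hR h)
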